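/- Consider the planar rotating Kepler problem, i.e. the Hamiltonian $H=E+L$ on $T^*(\mathbb R^2\setminus\{0\})$ with $E(q,p)=\tfrac12|p|^2-\tfrac1{|q|}$, $L(q,p)=q_1p_2-q_2p_1$, $\omega=\sum dp_i\wedge dq_i$ and Hamiltonian vector field given by $\omega(X_H,\cdot)=-dH$. A (collision-free) trajectory is called circular if its eccentricity vanishes, i.e. $2EL^2+1=0$ along it; a circular trajectory is called retrograde if $L>0$ and direct if $L<0$. Note that $E<0$ on a circular trajectory. Index. Let $\gamma$ be a circular trajectory, $-c$ its value of $H$, and $\lambda=-q\,dp$, with Reeb vector field $R=X_H/\lambda(X_H)$ on $H^{-1}(-c)$. Stereographic projection $\Pi:T^*S^2\to T^*\mathbb R^2$ (with $p$ as base coordinate and $-q$ as fiber coordinate) identifies $\lambda$ with $\eta\,d\xi$ on $T^*S^2=\{(\xi,\eta)\in\mathbb R^3\times\mathbb R^3: |\xi|=1,\ \xi\cdot\eta=0\}$ and $H^{-1}(-c)$ with an open part of the zero set of the regularized Hamiltonian $$K(\xi,\eta)=|\eta|\bigl(1+(1-\xi_3)(c-\tfrac12+\xi_1\eta_2-\xi_2\eta_1)\bigr)-1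 .$$ The contact structure $\ker\lambda\cap\ker dK$ is trivialized by the frame $$X_1=\Bigl(\xi\times\eta-\tfrac{(\xi\times\eta)\cdot\partial_\eta K}{\eta\cdot\partial_\eta K}\,\eta\Bigr)\cdot\partial_\eta,\qquad X_2=(\xi\times\eta)\cdot\partial_\xi-\tfrac{(\xi\times\eta)\cdot\partial_\xi K}{\eta\cdot\partial_\eta K}\,\eta\cdot\partial_\eta ,$$ divided by $|\xi\times\eta|$ to make it symplectic. (For $c>\tfrac32$ it is defined on the whole bounded component of the regularized energy hypersurface.) In this frame the linearized Reeb flow along $\gamma$, restricted to the contact structure, is a path $\psi$ in $Sp(2)$ with $\psi(0)=1$. If $T$ is a period of $\gamma$ and $\tau=\int_0^T\gamma^*\lambda$ is the corresponding Reeb period, the closed orbit $\gamma|_{[0,T]}$ is called nondegenerate if $\det(\psi(\tau)-1)\neq0$, and its Conley–Zehnder index is the Robbin–Salamon Maslov index of $\psi|_{[0,\tau]}$: for a path with only isolated, nondegenerate crossings ($\det(\psi(t)-1)=0$) it is the sum over the crossings in $(0,\tau)$ of the signatures of the forms $v\mapsto\omega_0(v,\dot\psi(t)v)$ on $\ker(\psi(t)-1)$,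 where $\omega_0=dx\wedge dy$, plus half of these signatures at crossings at $0$ and $\tau$; for other paths it is defined by perturbation with fixed endpoints. **Proposition.** (1) Let $\gamma_+$ be a retrograde circular trajectory of Kepler energy $E$. Then its minimal period is $$S_+=\frac{2\pi}{(-2E)^{3/2}+1}.$$ If $N\in\mathbb N$ and $NS_+\notin\mathbb Z\,\frac{2\pi}{(-2E)^{3/2}}$, then the $N$-th iterate $\gamma_+|_{[0,NS_+]}$ is nondegenerate, and its Conley–Zehnder index is $$1+2\max\Bigl\{k\in\mathbb Z\ \Bigm|\ k\,\tfrac{2\pi}{(-2E)^{3/2}}<NS_+\Bigr\}.$$ (2) Let $\gamma_-$ be a direct circular trajectory of Kepler energy $E<-\tfrac12$. Then its minimal period is $$S_-=\frac{2\pi}{(-2E)^{3/2}-1}.$$ If $N\in\mathbb N$ and $NS_-\notin\mathbb Z\,\frac{2\pi}{(-2E)^{3/2}}$, then the $N$-th iterate $\gamma_-|_{[0,NS_-]}$ is nondegenerate, and its Conley–Zehnder index is $$1+2\max\Bigl\{k\in\mathbb Z\ \Bigm|\ k\,\tfrac{2\pi}{(-2E)^{3/2}}<NS_-\Bigr\}.$$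 -/

import Mathlib

open scoped Matrix

noncomputable section

/-! ### The Maslov index of a path of symplectic matrices

Paths in `Sp(2n)` are functions `ψ : ℝ → Matrix (Fin n ⊕ Fin n) (Fin n ⊕ Fin n) ℝ` of which only
the values on `[0, T]` matter. The summand `inl` carries the coordinates `x`, the summand `inr`
the coordinates `y`, and the symplectic form is `ω₀ = dx ∧ dy`. -/

namespace SymplecticPath

variable {n : ℕ}

/-- The time derivative `ψ'(t)` of a path on `[0, T]` (one-sided at the endpoints). -/
def velocity (T : ℝ) (ψ : ℝ → Matrix (Fin n ⊕ Fin n) (Fin n ⊕ Fin n) ℝ) (t : ℝ) :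
    Matrix (Fin n ⊕ Fin n) (Fin n ⊕ Fin n) ℝ :=
  Matrix.of fun i j => derivWithin (fun s => ψ s i j) (Set.Icc 0 T) t

/-- `t` is a crossing if `det (ψ(t) - 1) = 0`. -/
def IsCrossing (ψ : ℝ → Matrix (Fin n ⊕ Fin n) (Fin n ⊕ Fin n) ℝ) (t : ℝ) : Prop :=
  (ψ t - 1).det = 0

/-- `V_t = ker (ψ(t) - 1)`. -/
def fixedSpace (ψ : ℝ → Matrix (Fin n ⊕ Fin n) (Fin n ⊕ Fin n) ℝ) (t : ℝ) :
    Submodule ℝ (Fin n ⊕ Fin n → ℝ) :=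
  LinearMap.ker (Matrix.toLin' (ψ t - 1))

/-- The crossing form `v ↦ ω₀(v, ψ'(t) v)` on `V_t`. The matrix of `ω₀ = dx ∧ dy` is `-J`,
because `Matrix.J` is the block matrix `[[0, -1], [1, 0]]`. -/
def crossingForm (T : ℝ) (ψ : ℝ → Matrix (Fin n ⊕ Fin n) (Fin n ⊕ Fin n) ℝ) (t : ℝ) :
    QuadraticForm ℝ (fixedSpace ψ t) :=
  QuadraticMap.restrict (-(Matrix.J (Fin n) ℝ) * velocity T ψ t).toQuadraticForm' (fixedSpace ψ t)

/-- The signature of the crossing form at `t`; it is `0` if `t` is not a crossing, since then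
`V_t = 0`. -/
def crossingSignature (T : ℝ) (ψ : ℝ → Matrix (Fin n ⊕ Fin n) (Fin n ⊕ Fin n) ℝ) (t : ℝ) : ℤ :=
  (sigPos (crossingForm T ψ t) : ℤ) - (sigNeg (crossingForm T ψ t) : ℤ)

/-- A continuously differentiable path in `Sp(2n)` on `[0, T]` all of whose crossings are isolated
(that is, finite in number, as `[0, T]` is compact) and nondegenerate. -/
structure IsRegular (T : ℝ) (ψ : ℝ → Matrix (Fin n ⊕ Fin n) (Fin n ⊕ Fin n) ℝ) : Prop where
  contDiffOn : ∀ i j, ContDiffOn ℝ 1 (fun t => ψ t i j) (Set.Icc 0 T)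
  symplectic : ∀ t ∈ Set.Icc 0 T, ψ t ∈ Matrix.symplecticGroup (Fin n) ℝ
  isolated : {t ∈ Set.Icc 0 T | IsCrossing ψ t}.Finite
  nondegenerate : ∀ t ∈ Set.Icc 0 T, IsCrossing ψ t →
    (QuadraticMap.polarBilin (crossingForm T ψ t)).Nondegenerate

/-- Half the signature at each endpoint, plus the signatures at the interior crossings. -/
def crossingSum (T : ℝ) (ψ : ℝ → Matrix (Fin n ⊕ Fin n) (Fin n ⊕ Fin n) ℝ) : ℝ :=
  1 / 2 * (crossingSignature T ψ 0 : ℝ)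
    + ∑ᶠ t ∈ {t ∈ Set.Ioo 0 T | IsCrossing ψ t}, (crossingSignature T ψ t : ℝ)
    + 1 / 2 * (crossingSignature T ψ T : ℝ)

/-- Two paths in `Sp(2n)` on `[0, T]` are homotopic with fixed endpoints. -/
def Homotopic (T : ℝ) (ψ₀ ψ₁ : ℝ → Matrix (Fin n ⊕ Fin n) (Fin n ⊕ Fin n) ℝ) : Prop :=
  ∃ F : ℝ → ℝ → Matrix (Fin n ⊕ Fin n) (Fin n ⊕ Fin n) ℝ,
    ContinuousOn (fun x : ℝ × ℝ => F x.1 x.2) (Set.Icc 0 1 ×ˢ Set.Icc 0 T) ∧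
    (∀ s ∈ Set.Icc (0 : ℝ) 1, ∀ t ∈ Set.Icc 0 T, F s t ∈ Matrix.symplecticGroup (Fin n) ℝ) ∧
    (∀ t ∈ Set.Icc 0 T, F 0 t = ψ₀ t ∧ F 1 t = ψ₁ t) ∧
    (∀ s ∈ Set.Icc (0 : ℝ) 1, F s 0 = ψ₀ 0 ∧ F s T = ψ₀ T)

open Classical in
/-- The Maslov index (in the sense of Robbin and Salamon) of a path of symplectic matrices on
`[0, T]`: the sum over crossings if the path is regular; otherwise this sum for a regular path
which is homotopic to it with fixed endpoints. -/
def maslovIndex (T : ℝ) (ψ : ℝ → Matrix (Fin n ⊕ Fin n) (Fin n ⊕ Fin n) ℝ) : ℝ :=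
  if IsRegular T ψ then crossingSum T ψ
  else if h : ∃ ψ', IsRegular T ψ' ∧ Homotopic T ψ ψ' then crossingSum T h.choose
  else 0

end SymplecticPath

/-! ### The rotating Kepler problem -/

namespace RotatingKepler

/-- Points `(q, p)` of `T*ℝ²`; the rotating Kepler problem lives on the part where `q ≠ 0`. -/
abbrev Phase : Type := EuclideanSpace ℝ (Fin 2) × EuclideanSpace ℝ (Fin 2)

/-- The Kepler energy `E = |p|² / 2 - 1 / |q|`. -/
def keplerEnergy (z : Phase) : ℝ := 1 / 2 * ‖z.2‖ ^ 2 - 1 / ‖z.1‖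

/-- The angular momentum `L = q₁ p₂ - q₂ p₁`. -/
def angularMomentum (z : Phase) : ℝ := z.1 0 * z.2 1 - z.1 1 * z.2 0

/-- The Hamiltonian `H = E + L` of the rotating Kepler problem. -/
def hamiltonian (z : Phase) : ℝ := keplerEnergy z + angularMomentum z

/-- The Hamiltonian vector field of `F`, given by `ω(X_F, ·) = -dF` for `ω = ∑ dpᵢ ∧ dqᵢ`, so that
`q' = ∂F/∂p` and `p' = -∂F/∂q`. -/
def hamiltonianVectorField (F : Phase → ℝ) (z : Phase) : Phase :=
  (WithLp.toLp 2 fun i => fderiv ℝ F z (0, EuclideanSpace.single i 1),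
   WithLp.toLp 2 fun i => -fderiv ℝ F z (EuclideanSpace.single i 1, 0))

/-- The square `ε² = 2 E L² + 1` of the eccentricity of the Kepler ellipse through `z`. -/
def eccentricitySq (z : Phase) : ℝ := 2 * keplerEnergy z * angularMomentum z ^ 2 + 1

/-- `γ` is a (collision-free) trajectory of the rotating Kepler problem. -/
def IsTrajectory (γ : ℝ → Phase) : Prop :=
  ∀ t, (γ t).1 ≠ 0 ∧ HasDerivAt γ (hamiltonianVectorField hamiltonian (γ t)) t

/-- Circular trajectories are those of eccentricity zero. -/
def IsCircular (γ : ℝ → Phase) : Prop := ∀ t, eccentricitySq (γ t) = 0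

/-- Retrograde: the motion is opposite to the rotation of the coordinate system. -/
def IsRetrograde (γ : ℝ → Phase) : Prop := ∀ t, 0 < angularMomentum (γ t)

/-- Direct: the motion is in the direction of the rotation of the coordinate system. -/
def IsDirect (γ : ℝ → Phase) : Prop := ∀ t, angularMomentum (γ t) < 0

/-- `S` is the period of the simple closed orbit `γ`, that is, its least positive period. -/
def IsMinimalPeriod (γ : ℝ → Phase) (S : ℝ) : Prop :=
  IsLeast {T : ℝ | 0 < T ∧ ∀ t, γ (t + T) = γ t} S

/-! ### Contact form and Reeb flow -/

/-- The 1-form `λ = -q dp`, a primitive of `ω`, evaluated on the tangent vector `v` at `z`. -/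
def liouvilleForm (z v : Phase) : ℝ := -inner ℝ z.1 v.2

/-- The Reeb vector field `R = X_H / λ(X_H)` of `λ` on the level sets of `H`. -/
def reebField (z : Phase) : Phase :=
  (liouvilleForm z (hamiltonianVectorField hamiltonian z))⁻¹ •
    hamiltonianVectorField hamiltonian z

/-- The action `∫ γ*λ` over `[0, t]`, which is the Reeb time that `γ` needs from `γ(0)` to
`γ(t)`. -/
def action (γ : ℝ → Phase) (t : ℝ) : ℝ := ∫ s in (0 : ℝ)..t, liouvilleForm (γ s) (deriv γ s)

/-! ### Moser regularization and the global trivialization of the contact structure -/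

/-- `ℝ³ × ℝ³`, which contains `T*S²` as the set of all `(ξ, η)` with `|ξ| = 1` and `ξ · η = 0`. -/
abbrev Ambient : Type := EuclideanSpace ℝ (Fin 3) × EuclideanSpace ℝ (Fin 3)

/-- Inverse stereographic projection `T*ℝ² → T*S²` from the north pole. The base coordinate in
`T*ℝ²` is `p` and the fiber coordinate is `y = -q`, so that `η dξ` pulls back to `y dp = -q dp`. -/
def stereoInv (z : Phase) : Ambient :=
  (!₂[2 * z.2 0 / (‖z.2‖ ^ 2 + 1), 2 * z.2 1 / (‖z.2‖ ^ 2 + 1),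
      (‖z.2‖ ^ 2 - 1) / (‖z.2‖ ^ 2 + 1)],
   !₂[-((‖z.2‖ ^ 2 + 1) / 2 * z.1 0 - inner ℝ z.2 z.1 * z.2 0),
      -((‖z.2‖ ^ 2 + 1) / 2 * z.1 1 - inner ℝ z.2 z.1 * z.2 1),
      -inner ℝ z.2 z.1])

/-- Stereographic projection `Π : T*S² → T*ℝ²`, defined off the fiber over the north pole (and, by
the same formula, on a neighbourhood in `ℝ³ × ℝ³`). -/
def stereo (w : Ambient) : Phase :=
  (!₂[-((1 - w.1 2) * w.2 0 + w.2 2 * w.1 0), -((1 - w.1 2) * w.2 1 + w.2 2 * w.1 1)],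
   !₂[w.1 0 / (1 - w.1 2), w.1 1 / (1 - w.1 2)])

/-- The regularized Hamiltonian on `T*S²`: the function which in stereographic coordinates is
`|q| (H(q, p) + c)`. Its zero set is the regularized energy hypersurface of Jacobi energy `-c`. -/
def regularizedHamiltonian (c : ℝ) (w : Ambient) : ℝ :=
  ‖w.2‖ * (1 + (1 - w.1 2) * (c - 1 / 2 + (w.1 0 * w.2 1 - w.1 1 * w.2 0))) - 1

/-- The vector `ξ × η`. -/
def crossVec (w : Ambient) : EuclideanSpace ℝ (Fin 3) := 
  WithLp.toLp 2 (crossProduct w.1.ofLp w.2.ofLp)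

/-- With `K` the regularized Hamiltonian, the vector field
`X₁ = (ξ × η - ((ξ × η) · ∂_η K / η · ∂_η K) η) · ∂_η` in `ker λ ∩ ker dK`. -/
def globalX₁ (c : ℝ) (w : Ambient) : Ambient :=
  (0, crossVec w -
    (fderiv ℝ (regularizedHamiltonian c) w (0, crossVec w) /
      fderiv ℝ (regularizedHamiltonian c) w (0, w.2)) • w.2)

/-- With `K` the regularized Hamiltonian, the vector field
`X₂ = (ξ × η) · ∂_ξ - ((ξ × η) · ∂_ξ K / η · ∂_η K) η · ∂_η` in `ker λ ∩ ker dK`. -/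
def globalX₂ (c : ℝ) (w : Ambient) : Ambient :=
  (crossVec w,
    -(fderiv ℝ (regularizedHamiltonian c) w (crossVec w, 0) /
      fderiv ℝ (regularizedHamiltonian c) w (0, w.2)) • w.2)

/-- The frame `(X₁, X₂)`, normalized to a symplectic frame (`dλ(X₁, X₂) = |ξ × η|²` before
normalization) and carried over to `T*ℝ²` by stereographic projection. -/
def contactFrame (c : ℝ) (z : Phase) : Fin 1 ⊕ Fin 1 → Phase :=
  Sum.elim
    (fun _ => fderiv ℝ stereo (stereoInv z)
      (‖crossVec (stereoInv z)‖⁻¹ • globalX₁ c (stereoInv z)))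
    (fun _ => fderiv ℝ stereo (stereoInv z)
      (‖crossVec (stereoInv z)‖⁻¹ • globalX₂ c (stereoInv z)))

/-! ### The Conley-Zehnder index -/

/-- `ψ` is the linearized Reeb flow, restricted to the contact structure and written in the global
trivialization, along the Reeb orbit that parametrizes the trajectory `γ` of `X_H`. Here `α` is the
reparametrization of `γ` by Reeb time, and `Φ` is the linearized Reeb flow along `α`, the solution
of the variational equation with `Φ(0) = 1`. -/
def IsContactLinearization (γ : ℝ → Phase)
    (ψ : ℝ → Matrix (Fin 1 ⊕ Fin 1) (Fin 1 ⊕ Fin 1) ℝ) : Prop :=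
  ∃ (α : ℝ → Phase) (Φ : ℝ → Phase →L[ℝ] Phase),
    (∀ t, α (action γ t) = γ t) ∧
    (∀ s, HasDerivAt α (reebField (α s)) s) ∧
    Φ 0 = ContinuousLinearMap.id ℝ Phase ∧
    (∀ s, HasDerivAt Φ ((fderiv ℝ reebField (α s)).comp (Φ s)) s) ∧
    ∀ s j, Φ s (contactFrame (-hamiltonian (γ 0)) (α 0) j) =
      ∑ i, ψ s i j • contactFrame (-hamiltonian (γ 0)) (α s) i

/-- The closed orbit `γ|[0, T]` is nondegenerate: `1` is not an eigenvalue of the linearized return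
map of the Reeb flow on the contact structure. -/
def IsNondegenerateOrbit (γ : ℝ → Phase) (T : ℝ) : Prop :=
  (∃ ψ, IsContactLinearization γ ψ) ∧
    ∀ ψ, IsContactLinearization γ ψ → (ψ (action γ T) - 1).det ≠ 0

/-- The closed orbit `γ|[0, T]` has Conley-Zehnder index `μ`: this is the Maslov index of the
linearized Reeb flow on the contact structure over one Reeb period of the orbit. -/
def HasConleyZehnderIndex (γ : ℝ → Phase) (T : ℝ) (μ : ℝ) : Prop :=
  (∃ ψ, IsContactLinearization γ ψ) ∧
    ∀ ψ, IsContactLinearization γ ψ → SymplecticPath.maslovIndex (action γ T) ψ = μ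

end RotatingKepler

end

open RotatingKepler

/-!
Vanishing eccentricity forces `|q| = L²` and `p = L⁻³ Jq`, where `J` is the quarter turn
(`eq_of_eccentricitySq_eq_zero`), so that a circular trajectory of angular momentum `ℓ` is a uniform
rotation of angular velocity `1 + ℓ⁻³` (`eq_circ_of_isCircular`). Since `-2E = ℓ⁻²`, this gives the
minimal period. Along it `λ(X_H) = ℓ⁻² + ℓ` is constant, and it is positive in the retrograde case
and for direct orbits with `E < -1/2`; in Reeb time the orbit rotates with angular velocity `ℓ⁻¹`.

The problem is invariant under rotations, so in the frame that rotates with the orbit the linearized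
Reeb flow has constant coefficients (`fderiv_reebField_rot`). This shows that it exists and is
unique. On the contact plane, which is spanned by a vector `angularVec` that moves `q` along the
orbit and a vector `radialVec` that moves `q` radially, the constant matrix sends
`angularVec` to `ν radialVec` and `radialVec` to `-ν angularVec`, with `ν = 1 / (ℓ(1 + ℓ³))`
(`fderiv_reebField_angularVec`, `fderiv_reebField_radialVec`). These are the epicyclic oscillations,
of period `2π|ℓ|³ = 2π / (-2E)^(3/2)` in the time of `X_H`.

Along the orbit the two vectors of the global frame are multiples of `angularVec` and `radialVec`
(`contactFrame_circ`), and the ratio `ρ` of the two factors has the sign of `ℓ`. In the global frame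
the linearized flow is therefore the elliptic path `[[cos νt, -ρ⁻¹ sin νt], [ρ sin νt, cos νt]]`
with `ρν > 0` (`isContactLinearization_iff`). Its crossings are the multiples of the epicyclic
period; there the path is the identity and the crossing form is positive definite of rank two. The
crossing at `0` contributes `1` to the index and each crossing in the interior contributes `2`
(`maslovIndex_ellipticPath`).
-/

noncomputable section

/-! ### The Maslov index of an elliptic path in `Sp(2)` -/

namespace SymplecticPath

/-- If the crossing form is positive definite, its signature is the dimension of `V_t`. -/
lemma crossingSignature_of_posDef {n : ℕ} {T t : ℝ}
    {ψ : ℝ → Matrix (Fin n ⊕ Fin n) (Fin n ⊕ Fin n) ℝ} (h : (crossingForm T ψ t).PosDef) :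
    crossingSignature T ψ t = Module.finrank ℝ (fixedSpace ψ t) := by
  have h1 : Module.finrank ℝ (⊤ : Submodule ℝ (fixedSpace ψ t)) ≤
      sigPos (crossingForm T ψ t) :=
    le_sigPos_of_posDef _ fun x hx => h x (by simpa using hx)
  rw [finrank_top] at h1
  have h2 := QuadraticForm.sigPos_add_sigNeg_add_radical (Q := crossingForm T ψ t)
  unfold crossingSignature
  omega

/-- The path of matrices `[[cos νt, -ρ⁻¹ sin νt], [ρ sin νt, cos νt]]`, which is conjugate to a
rotation of frequency `ν`. -/
def ellipticPath (ρ ν t : ℝ) : Matrix (Fin 1 ⊕ Fin 1) (Fin 1 ⊕ Fin 1) ℝ :=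
  Matrix.of fun i j => Sum.elim
    (fun _ => Sum.elim (fun _ => Real.cos (ν * t)) (fun _ => -(ρ⁻¹ * Real.sin (ν * t))) j)
    (fun _ => Sum.elim (fun _ => ρ * Real.sin (ν * t)) (fun _ => Real.cos (ν * t)) j) i

variable {ρ ν : ℝ}

lemma det_ellipticPath_sub_one (hρ : ρ ≠ 0) (t : ℝ) :
    (ellipticPath ρ ν t - 1).det = 2 * (1 - Real.cos (ν * t)) := by
  rw [← Matrix.det_submatrix_equiv_self finSumFinEquiv.symm, Matrix.det_fin_two]
  have h0 : (finSumFinEquiv.symm (0 : Fin (1 + 1)) : Fin 1 ⊕ Fin 1) = Sum.inl 0 := rfl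
  have h1 : (finSumFinEquiv.symm (1 : Fin (1 + 1)) : Fin 1 ⊕ Fin 1) = Sum.inr 0 := rfl
  simp only [Matrix.submatrix_apply, h0, h1, Matrix.sub_apply, ellipticPath, Matrix.of_apply,
    Sum.elim_inl, Sum.elim_inr, Matrix.one_apply_eq, Matrix.one_apply_ne, ne_eq, reduceCtorEq,
    not_false_eq_true, sub_zero]
  have := Real.sin_sq_add_cos_sq (ν * t)
  field_simp
  linear_combination this

lemma isCrossing_ellipticPath (hρ : ρ ≠ 0) {t : ℝ} :
    IsCrossing (ellipticPath ρ ν) t ↔ ∃ m : ℤ, (m : ℝ) * (2 * Real.pi) = ν * t := by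
  rw [IsCrossing, det_ellipticPath_sub_one hρ, ← Real.cos_eq_one_iff]
  constructor <;> intro h <;> linarith

lemma sin_eq_zero_of_isCrossing (hρ : ρ ≠ 0) {t : ℝ} (h : IsCrossing (ellipticPath ρ ν) t) :
    Real.sin (ν * t) = 0 ∧ Real.cos (ν * t) = 1 := by
  obtain ⟨m, hm⟩ := (isCrossing_ellipticPath hρ).1 h
  have hc : Real.cos (ν * t) = 1 := (Real.cos_eq_one_iff _).2 ⟨m, hm⟩
  exact ⟨Real.sin_eq_zero_iff_cos_eq.2 (Or.inl hc), hc⟩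

lemma ellipticPath_eq_one_of_isCrossing (hρ : ρ ≠ 0) {t : ℝ}
    (h : IsCrossing (ellipticPath ρ ν) t) : ellipticPath ρ ν t = 1 := by
  obtain ⟨hs, hc⟩ := sin_eq_zero_of_isCrossing hρ h
  ext (i | i) (j | j) <;> fin_cases i <;> fin_cases j <;> simp [ellipticPath, hs, hc]

lemma fixedSpace_eq_top (hρ : ρ ≠ 0) {t : ℝ} (h : IsCrossing (ellipticPath ρ ν) t) :
    fixedSpace (ellipticPath ρ ν) t = ⊤ := by
  rw [fixedSpace, ellipticPath_eq_one_of_isCrossing hρ h]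
  simp

lemma fixedSpace_eq_bot {n : ℕ} {ψ : ℝ → Matrix (Fin n ⊕ Fin n) (Fin n ⊕ Fin n) ℝ} {t : ℝ}
    (h : ¬ IsCrossing ψ t) : fixedSpace ψ t = ⊥ := by
  rw [fixedSpace, Matrix.ker_toLin'_eq_bot_iff]
  intro v hv
  by_contra hne
  exact h (Matrix.exists_mulVec_eq_zero_iff.1 ⟨v, hne, hv⟩)

lemma contDiff_ellipticPath (i j : Fin 1 ⊕ Fin 1) :
    ContDiff ℝ 1 fun t => ellipticPath ρ ν t i j := by
  rcases i with i | i <;> rcases j with j | j <;>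
    simp only [ellipticPath, Matrix.of_apply, Sum.elim_inl, Sum.elim_inr] <;> fun_prop

lemma velocity_ellipticPath {T t : ℝ} (hT : 0 < T) (ht : t ∈ Set.Icc 0 T) :
    velocity T (ellipticPath ρ ν) t = Matrix.of fun i j => Sum.elim
      (fun _ => Sum.elim (fun _ => -(ν * Real.sin (ν * t)))
        (fun _ => -(ρ⁻¹ * (ν * Real.cos (ν * t)))) j)
      (fun _ => Sum.elim (fun _ => ρ * (ν * Real.cos (ν * t)))
        (fun _ => -(ν * Real.sin (ν * t))) j) i := by
  have hu := uniqueDiffOn_Icc hT t ht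
  have hν : HasDerivAt (fun s : ℝ => ν * s) ν t := by
    simpa using (hasDerivAt_id t).const_mul ν
  have hc : HasDerivAt (fun s : ℝ => Real.cos (ν * s)) (-(ν * Real.sin (ν * t))) t := by
    convert! hν.cos using 1; ring
  have hs : HasDerivAt (fun s : ℝ => Real.sin (ν * s)) (ν * Real.cos (ν * t)) t := by
    convert! hν.sin using 1; ring
  ext (i | i) (j | j)
  · exact hc.hasDerivWithinAt.derivWithin hu
  · exact (hs.const_mul ρ⁻¹).neg.hasDerivWithinAt.derivWithin hu
  · exact (hs.const_mul ρ).hasDerivWithinAt.derivWithin hu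
  · exact hc.hasDerivWithinAt.derivWithin hu

/-- At a crossing the path is the identity and its velocity is `[[0, -ρ⁻¹ν], [ρν, 0]]`, so that
the crossing form is `ρν x² + ρ⁻¹ν y²`. -/
lemma posDef_crossingForm (hρν : 0 < ρ * ν) {T t : ℝ} (hT : 0 < T) (ht : t ∈ Set.Icc 0 T) :
    (crossingForm T (ellipticPath ρ ν) t).PosDef := by
  have hρ : ρ ≠ 0 := left_ne_zero_of_mul hρν.ne'
  intro x hx
  by_cases h : IsCrossing (ellipticPath ρ ν) t
  · obtain ⟨hs, hc⟩ := sin_eq_zero_of_isCrossing hρ h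
    have hform : crossingForm T (ellipticPath ρ ν) t x =
        ρ * ν * (x.1 (Sum.inl 0) ^ 2 + (ρ⁻¹ * x.1 (Sum.inr 0)) ^ 2) := by
      simp only [crossingForm, QuadraticMap.restrict_apply, Matrix.toQuadraticForm',
        LinearMap.BilinMap.toQuadraticMap_apply, Matrix.toLinearMap₂'_apply',
        velocity_ellipticPath hT ht, hs, hc]
      simp [Matrix.J, Matrix.fromBlocks, Matrix.mul_apply, Matrix.mulVec, dotProduct]
      field_simp
    rw [hform]
    refine mul_pos hρν ?_
    by_contra! hle
    have hx1 := sq_nonneg (x.1 (Sum.inl 0))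
    have hx2 := sq_nonneg (ρ⁻¹ * x.1 (Sum.inr 0))
    have h1 : x.1 (Sum.inl 0) = 0 := pow_eq_zero_iff two_ne_zero |>.1 (by linarith)
    have h2 : ρ⁻¹ * x.1 (Sum.inr 0) = 0 := pow_eq_zero_iff two_ne_zero |>.1 (by linarith)
    refine hx (Subtype.ext (funext ?_))
    rintro (i | i) <;> fin_cases i
    · simpa using h1
    · simpa [hρ] using h2
  · exact absurd (Subtype.ext ((Submodule.mem_bot ℝ).1 (fixedSpace_eq_bot h ▸ x.2))) hx

lemma ellipticPath_mem_symplecticGroup (hρ : ρ ≠ 0) (t : ℝ) :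
    ellipticPath ρ ν t ∈ Matrix.symplecticGroup (Fin 1) ℝ := by
  have := Real.sin_sq_add_cos_sq (ν * t)
  rw [SymplecticGroup.mem_iff]
  ext (i | i) (j | j) <;> fin_cases i <;> fin_cases j <;>
    simp [ellipticPath, Matrix.J, Matrix.fromBlocks, Matrix.mul_apply] <;> field_simp <;>
    first | linear_combination this | linear_combination -this | ring

/-- The crossings lie at the multiples of `2π / |ν|`. -/
lemma isCrossing_ellipticPath_iff (hρν : 0 < ρ * ν) {τ : ℝ} (hτ : τ = 2 * Real.pi / |ν|) {t : ℝ} :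
    IsCrossing (ellipticPath ρ ν) t ↔ ∃ m : ℤ, t = m * τ := by
  have hν : ν ≠ 0 := right_ne_zero_of_mul hρν.ne'
  rw [isCrossing_ellipticPath (left_ne_zero_of_mul hρν.ne'), hτ]
  rcases hν.lt_or_gt with h | h
  · rw [abs_of_neg h]
    constructor
    · rintro ⟨m, hm⟩
      refine ⟨-m, ?_⟩
      push_cast
      field_simp
      linarith
    · rintro ⟨m, rfl⟩
      refine ⟨-m, ?_⟩
      push_cast
      field_simp
  · rw [abs_of_pos h]
    constructor
    · rintro ⟨m, hm⟩
      refine ⟨m, ?_⟩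
      field_simp
      linarith
    · rintro ⟨m, rfl⟩
      refine ⟨m, ?_⟩
      field_simp

/-- If `k` is the greatest integer with `kτ < T`, the crossings in `(0, T)` are
`τ, 2τ, …, kτ`. -/
lemma crossings_Ioo (hρν : 0 < ρ * ν) {τ T : ℝ} (hτ : τ = 2 * Real.pi / |ν|) {k : ℤ}
    (hk : IsGreatest {k : ℤ | (k : ℝ) * τ < T} k) :
    {t ∈ Set.Ioo 0 T | IsCrossing (ellipticPath ρ ν) t} =
      ((Finset.Icc 1 k).image fun m : ℤ => (m : ℝ) * τ : Finset ℝ) := by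
  have hτ0 : 0 < τ := by
    rw [hτ]
    have := abs_pos.2 (right_ne_zero_of_mul hρν.ne')
    positivity
  ext t
  simp only [Set.mem_ofPred_eq, Set.mem_Ioo, isCrossing_ellipticPath_iff hρν hτ, Finset.coe_image,
    Finset.coe_Icc, Set.mem_image, Set.mem_Icc]
  constructor
  · rintro ⟨⟨h0, hT⟩, m, rfl⟩
    have hm : (0 : ℝ) < m := pos_of_mul_pos_left h0 hτ0.le
    exact ⟨m, ⟨by exact_mod_cast hm, hk.2 hT⟩, rfl⟩
  · rintro ⟨m, ⟨h1, hmk⟩, rfl⟩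
    have hm : (0 : ℝ) < m := by exact_mod_cast h1
    have hmk' : (m : ℝ) ≤ k := by exact_mod_cast hmk
    exact ⟨⟨by positivity, (mul_le_mul_of_nonneg_right hmk' hτ0.le).trans_lt hk.1⟩, m, rfl⟩

lemma isRegular_ellipticPath (hρν : 0 < ρ * ν) {T : ℝ} (hT : 0 < T) :
    IsRegular T (ellipticPath ρ ν) where
  contDiffOn i j := (contDiff_ellipticPath i j).contDiffOn
  symplectic t _ := ellipticPath_mem_symplecticGroup (left_ne_zero_of_mul hρν.ne') t
  isolated := by
    have hν := abs_pos.2 (right_ne_zero_of_mul hρν.ne')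
    refine ((Finset.Icc (0 : ℤ) ⌈T / (2 * Real.pi / |ν|)⌉).image
      fun m : ℤ => (m : ℝ) * (2 * Real.pi / |ν|)).finite_toSet.subset ?_
    rintro t ⟨⟨h0, hT⟩, hc⟩
    obtain ⟨m, rfl⟩ := (isCrossing_ellipticPath_iff hρν rfl).1 hc
    have hτ : 0 < 2 * Real.pi / |ν| := by positivity
    simp only [Finset.coe_image, Finset.coe_Icc, Set.mem_image, Set.mem_Icc]
    refine ⟨m, ⟨?_, ?_⟩, rfl⟩
    · exact_mod_cast nonneg_of_mul_nonneg_left h0 hτ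
    · exact_mod_cast ((le_div_iff₀ hτ).2 hT).trans (Int.le_ceil _)
  nondegenerate t ht _ := by
    rw [QuadraticMap.nondegenerate_polar_iff, QuadraticMap.nondegenerate_iff_radical_eq_bot,
      eq_bot_iff]
    exact fun x hx => (posDef_crossingForm hρν hT ht).anisotropic x
      (QuadraticMap.mem_radical_iff'.1 hx).1

lemma crossingSignature_ellipticPath (hρν : 0 < ρ * ν) {T t : ℝ} (hT : 0 < T)
    (ht : t ∈ Set.Icc 0 T) (hc : IsCrossing (ellipticPath ρ ν) t) :
    crossingSignature T (ellipticPath ρ ν) t = 2 := by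
  rw [crossingSignature_of_posDef (posDef_crossingForm hρν hT ht),
    fixedSpace_eq_top (left_ne_zero_of_mul hρν.ne') hc]
  simp

/-- An elliptic path turns in the positive direction, so its crossings at `0, τ, …, kτ` contribute
`1, 2, …, 2`. -/
lemma maslovIndex_ellipticPath (hρν : 0 < ρ * ν) {τ T : ℝ} (hT : 0 < T)
    (hτ : τ = 2 * Real.pi / |ν|) {k : ℤ} (hk : IsGreatest {k : ℤ | (k : ℝ) * τ < T} k)
    (hend : ∀ m : ℤ, T ≠ m * τ) :
    maslovIndex T (ellipticPath ρ ν) = 1 + 2 * k := by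
  have hρ : ρ ≠ 0 := left_ne_zero_of_mul hρν.ne'
  have hτ0 : 0 < τ := by
    rw [hτ]
    have := abs_pos.2 (right_ne_zero_of_mul hρν.ne')
    positivity
  have hk0 : 0 ≤ k := hk.2 (by simpa using hT)
  rw [maslovIndex, if_pos (isRegular_ellipticPath hρν hT), crossingSum]
  have h0 : crossingSignature T (ellipticPath ρ ν) 0 = 2 :=
    crossingSignature_ellipticPath hρν hT ⟨le_rfl, hT.le⟩
      ((isCrossing_ellipticPath_iff hρν hτ).2 ⟨0, by simp⟩)
  have hT' : crossingSignature T (ellipticPath ρ ν) T = 0 := by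
    rw [crossingSignature_of_posDef (posDef_crossingForm hρν hT ⟨hT.le, le_rfl⟩),
      fixedSpace_eq_bot fun h => ?_]
    · simp
    · obtain ⟨m, hm⟩ := (isCrossing_ellipticPath_iff hρν hτ).1 h
      exact hend m hm
  have hsum : ∑ᶠ t ∈ {t ∈ Set.Ioo 0 T | IsCrossing (ellipticPath ρ ν) t},
      (crossingSignature T (ellipticPath ρ ν) t : ℝ) = 2 * k := by
    rw [finsum_mem_congr rfl (g := fun _ => (2 : ℝ)), crossings_Ioo hρν hτ hk,
      finsum_mem_coe_finset, Finset.sum_const, Finset.card_image_of_injective]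
    · simp only [Int.card_Icc, add_sub_cancel_right, nsmul_eq_mul]
      have : ((k.toNat : ℤ) : ℝ) = k := by rw [Int.toNat_of_nonneg hk0]
      rw [← this]
      push_cast
      ring
    · intro a b hab
      exact_mod_cast mul_right_cancel₀ hτ0.ne' hab
    · rintro t ⟨ht, hc⟩
      rw [crossingSignature_ellipticPath hρν hT (Set.Ioo_subset_Icc_self ht) hc]
      norm_num
  rw [h0, hT', hsum]
  norm_num

end SymplecticPath

namespace RotatingKepler

/-! ### Rotations of phase space -/

/-- The generator of the rotations of the plane, the quarter turn `x ↦ (-x₂, x₁)`. -/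
def quarterTurn : EuclideanSpace ℝ (Fin 2) →L[ℝ] EuclideanSpace ℝ (Fin 2) :=
  LinearMap.toContinuousLinearMap
    { toFun := fun x => !₂[-x 1, x 0]
      map_add' := fun x y => by ext i; fin_cases i <;> simp [add_comm]
      map_smul' := fun c x => by ext i; fin_cases i <;> simp }

@[simp] lemma quarterTurn_apply (x : EuclideanSpace ℝ (Fin 2)) :
    quarterTurn x = !₂[-x 1, x 0] := rfl

/-- The quarter turn acting diagonally on `T*ℝ²`: the Hamiltonian vector field of `L`. -/
def rotGen : Phase →L[ℝ] Phase := quarterTurn.prodMap quarterTurn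

lemma rotGen_apply (z : Phase) : rotGen z = (quarterTurn z.1, quarterTurn z.2) := rfl

lemma phase_ext {z w : Phase} (h0 : z.1 0 = w.1 0) (h1 : z.1 1 = w.1 1)
    (h2 : z.2 0 = w.2 0) (h3 : z.2 1 = w.2 1) : z = w := by
  refine Prod.ext ?_ ?_ <;> ext i <;> fin_cases i <;> assumption

lemma rotGen_rotGen (z : Phase) : rotGen (rotGen z) = -z := by
  apply phase_ext <;> simp [rotGen_apply]

/-- The rotation by the angle `θ`, acting diagonally on `T*ℝ²`. -/
def rot (θ : ℝ) : Phase →L[ℝ] Phase :=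
  Real.cos θ • ContinuousLinearMap.id ℝ Phase + Real.sin θ • rotGen

lemma rot_apply_eq (θ : ℝ) (z : Phase) : rot θ z = Real.cos θ • z + Real.sin θ • rotGen z := rfl

lemma rot_zero : rot 0 = ContinuousLinearMap.id ℝ Phase := by
  ext1 <;> ext1 <;> simp [rot_apply_eq]

lemma rot_rot (a b : ℝ) (z : Phase) : rot a (rot b z) = rot (a + b) z := by
  simp only [rot_apply_eq, Real.cos_add, Real.sin_add, map_add, map_smul, rotGen_rotGen]
  module

lemma rotGen_rot (θ : ℝ) (z : Phase) : rotGen (rot θ z) = rot θ (rotGen z) := by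
  simp only [rot_apply_eq, map_add, map_smul]

lemma hasDerivAt_rot (θ : ℝ) : HasDerivAt rot (rotGen.comp (rot θ)) θ := by
  have h := ((Real.hasDerivAt_cos θ).smul_const (ContinuousLinearMap.id ℝ Phase)).add
    ((Real.hasDerivAt_sin θ).smul_const rotGen)
  refine h.congr_deriv (ContinuousLinearMap.ext fun z => ?_)
  simp only [add_apply, smul_apply,
    ContinuousLinearMap.comp_apply, rot_apply_eq, map_add, map_smul, rotGen_rotGen,
    ContinuousLinearMap.id_apply]
  module

/-- `rot θ` as an invertible map. -/
def rotEquiv (θ : ℝ) : Phase ≃L[ℝ] Phase :=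
  ContinuousLinearEquiv.equivOfInverse (rot θ) (rot (-θ))
    (fun z => by simp [rot_rot, rot_zero]) (fun z => by simp [rot_rot, rot_zero])

lemma rot_apply (θ : ℝ) (z : Phase) : rot θ z =
    (!₂[Real.cos θ * z.1 0 - Real.sin θ * z.1 1, Real.cos θ * z.1 1 + Real.sin θ * z.1 0],
     !₂[Real.cos θ * z.2 0 - Real.sin θ * z.2 1, Real.cos θ * z.2 1 + Real.sin θ * z.2 0]) := by
  apply phase_ext <;> simp [rot_apply_eq, rotGen_apply] <;> ring

lemma norm_rot_fst (θ : ℝ) (z : Phase) : ‖(rot θ z).1‖ = ‖z.1‖ := by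
  rw [rot_apply, EuclideanSpace.norm_eq, EuclideanSpace.norm_eq]
  congr 1
  simp only [Fin.sum_univ_two, Real.norm_eq_abs, sq_abs]
  simp
  linear_combination (z.1 0 ^ 2 + z.1 1 ^ 2) * Real.sin_sq_add_cos_sq θ

lemma angularMomentum_rot (θ : ℝ) (z : Phase) :
    angularMomentum (rot θ z) = angularMomentum z := by
  simp only [angularMomentum, rot_apply]
  simp
  linear_combination (z.1 0 * z.2 1 - z.1 1 * z.2 0) * Real.sin_sq_add_cos_sq θ

/-- The projection `(q, p) ↦ q`. -/
abbrev fstL : Phase →L[ℝ] EuclideanSpace ℝ (Fin 2) := ContinuousLinearMap.fst ℝ _ _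

/-- The projection `(q, p) ↦ p`. -/
abbrev sndL : Phase →L[ℝ] EuclideanSpace ℝ (Fin 2) := ContinuousLinearMap.snd ℝ _ _

/-! ### The Hamiltonian vector field and the Reeb field off the collisions -/

lemma hasFDerivAt_norm {n : ℕ} {x : EuclideanSpace ℝ (Fin n)} (hx : x ≠ 0) :
    HasFDerivAt (fun x : EuclideanSpace ℝ (Fin n) => ‖x‖) (‖x‖⁻¹ • innerSL ℝ x) x := by
  have h := (hasStrictFDerivAt_norm_sq x).hasFDerivAt.sqrt (by simpa using hx)
  simp only [Real.sqrt_sq (norm_nonneg _)] at h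
  refine h.congr_fderiv ?_
  ext v
  simp
  field_simp

/-- The coordinate `qᵢ` as a continuous linear map. -/
def coordQ (i : Fin 2) : Phase →L[ℝ] ℝ := (EuclideanSpace.proj i).comp fstL

/-- The coordinate `pᵢ` as a continuous linear map. -/
def coordP (i : Fin 2) : Phase →L[ℝ] ℝ := (EuclideanSpace.proj i).comp sndL

lemma hasFDerivAt_angularMomentum (z : Phase) :
    HasFDerivAt angularMomentum
      (z.1 0 • coordP 1 + z.2 1 • coordQ 0 - (z.1 1 • coordP 0 + z.2 0 • coordQ 1)) z :=
  ((coordQ 0).hasFDerivAt.mul (coordP 1).hasFDerivAt).sub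
    ((coordQ 1).hasFDerivAt.mul (coordP 0).hasFDerivAt)

lemma hasFDerivAt_norm_fst {z : Phase} (hz : z.1 ≠ 0) :
    HasFDerivAt (fun z : Phase => ‖z.1‖)
      (‖z.1‖⁻¹ • (innerSL ℝ z.1).comp fstL) z :=
  (hasFDerivAt_norm hz).comp z hasFDerivAt_fst

lemma hasFDerivAt_keplerEnergy {z : Phase} (hz : z.1 ≠ 0) :
    HasFDerivAt keplerEnergy
      ((innerSL ℝ z.2).comp sndL
        + (‖z.1‖ ^ 3)⁻¹ • (innerSL ℝ z.1).comp fstL) z := by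
  have hz' : ‖z.1‖ ≠ 0 := norm_ne_zero_iff.2 hz
  have h1 := (((hasStrictFDerivAt_norm_sq z.2).hasFDerivAt.comp z
    hasFDerivAt_snd).const_mul (1 / 2 : ℝ)).sub
      ((hasDerivAt_inv hz').comp_hasFDerivAt z (hasFDerivAt_norm_fst hz))
  have h2 : keplerEnergy = fun w : Phase => 1 / 2 * ‖w.2‖ ^ 2 - ‖w.1‖⁻¹ := by
    ext w
    simp [keplerEnergy]
  rw [h2]
  refine h1.congr_fderiv ?_
  ext v <;> simp
  field_simp

/-- The Hamiltonian vector field of the rotating Kepler problem off the collisions. -/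
def keplerField (z : Phase) : Phase :=
  (z.2 + quarterTurn z.1, -(‖z.1‖ ^ 3)⁻¹ • z.1 + quarterTurn z.2)

lemma hamiltonianVectorField_eq {z : Phase} (hz : z.1 ≠ 0) :
    hamiltonianVectorField hamiltonian z = keplerField z := by
  have h := ((hasFDerivAt_keplerEnergy hz).add (hasFDerivAt_angularMomentum z)).fderiv
  rw [show keplerEnergy + angularMomentum = hamiltonian from rfl] at h
  apply phase_ext <;>
    simp [hamiltonianVectorField, h, keplerField, coordQ, coordP, EuclideanSpace.inner_single_right]
  all_goals ring

/-- `λ(X_H) = 1 / |q| + L`. -/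
lemma liouvilleForm_keplerField {z : Phase} (hz : z.1 ≠ 0) :
    liouvilleForm z (keplerField z) = ‖z.1‖⁻¹ + angularMomentum z := by
  have hz' : ‖z.1‖ ≠ 0 := norm_ne_zero_iff.2 hz
  simp only [liouvilleForm, keplerField, inner_add_right, inner_smul_right,
    real_inner_self_eq_norm_sq]
  have : inner ℝ z.1 (quarterTurn z.2) = -angularMomentum z := by
    simp [PiLp.inner_apply, Fin.sum_univ_two, angularMomentum]
    ring
  rw [this]
  field_simp
  ring

/-- The Reeb vector field off the collisions. -/
def reebFormula (z : Phase) : Phase := (‖z.1‖⁻¹ + angularMomentum z)⁻¹ • keplerField z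

lemma reebField_eq {z : Phase} (hz : z.1 ≠ 0) : reebField z = reebFormula z := by
  rw [reebField, hamiltonianVectorField_eq hz, liouvilleForm_keplerField hz, reebFormula]

lemma reebField_eventuallyEq {z : Phase} (hz : z.1 ≠ 0) :
    reebField =ᶠ[nhds z] reebFormula := by
  have : ∀ᶠ w : Phase in nhds z, w.1 ≠ 0 := (continuous_fst.continuousAt).eventually_ne hz
  filter_upwards [this] with w hw using reebField_eq hw

lemma keplerField_rot (θ : ℝ) (z : Phase) : keplerField (rot θ z) = rot θ (keplerField z) := by
  simp only [keplerField, norm_rot_fst]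
  simp only [rot_apply]
  apply phase_ext <;> simp <;> ring

lemma reebFormula_rot (θ : ℝ) (z : Phase) : reebFormula (rot θ z) = rot θ (reebFormula z) := by
  simp only [reebFormula, norm_rot_fst, angularMomentum_rot, keplerField_rot, map_smul]

/-- The linearization of the Reeb field is equivariant under rotations. -/
lemma fderiv_reebField_rot (θ : ℝ) {z : Phase} (hz : z.1 ≠ 0) :
    (fderiv ℝ reebField (rot θ z)).comp (rot θ) =
      (rot θ).comp (fderiv ℝ reebField z) := by
  have hz' : (rot θ z).1 ≠ 0 := by rwa [← norm_ne_zero_iff, norm_rot_fst, norm_ne_zero_iff]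
  rw [(reebField_eventuallyEq hz').fderiv_eq, (reebField_eventuallyEq hz).fderiv_eq]
  have h : reebFormula ∘ rotEquiv θ = rotEquiv θ ∘ reebFormula :=
    funext fun w => reebFormula_rot θ w
  have h1 := (rotEquiv θ).comp_right_fderiv (f := reebFormula) (x := z)
  rw [h, (rotEquiv θ).comp_fderiv] at h1
  exact h1.symm

lemma hasFDerivAt_keplerField {z : Phase} (hz : z.1 ≠ 0) :
    HasFDerivAt keplerField
      ((sndL + quarterTurn.comp fstL).prod
        (-(‖z.1‖ ^ 3)⁻¹ • fstL
          + ((3 * (‖z.1‖ ^ 5)⁻¹) • (innerSL ℝ z.1).comp fstL).smulRight z.1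
          + quarterTurn.comp sndL)) z := by
  have hz' : ‖z.1‖ ≠ 0 := norm_ne_zero_iff.2 hz
  have hs : HasFDerivAt (fun w : Phase => -(‖w.1‖ ^ 3)⁻¹)
      ((3 * (‖z.1‖ ^ 5)⁻¹) • (innerSL ℝ z.1).comp fstL) z := by
    refine ((hasDerivAt_inv (pow_ne_zero 3 hz')).comp_hasFDerivAt z
      ((hasFDerivAt_norm_fst hz).pow 3)).neg.congr_fderiv ?_
    ext v <;> simp
    field_simp
  refine (hasFDerivAt_snd.add (quarterTurn.hasFDerivAt.comp z hasFDerivAt_fst)).prodMk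
    ((hs.smul hasFDerivAt_fst).add (quarterTurn.hasFDerivAt.comp z hasFDerivAt_snd))

lemma fderiv_reebField_apply {z : Phase} (hz : z.1 ≠ 0)
    (hμ : ‖z.1‖⁻¹ + angularMomentum z ≠ 0) (v : Phase) :
    fderiv ℝ reebField z v =
      (‖z.1‖⁻¹ + angularMomentum z)⁻¹ •
        (v.2 + quarterTurn v.1, -(‖z.1‖ ^ 3)⁻¹ • v.1
          + (3 * (‖z.1‖ ^ 5)⁻¹ * inner ℝ z.1 v.1) • z.1 + quarterTurn v.2)
      - (((‖z.1‖⁻¹ + angularMomentum z) ^ 2)⁻¹ * (-(‖z.1‖ ^ 3)⁻¹ * inner ℝ z.1 v.1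
          + (z.1 0 * v.2 1 + z.2 1 * v.1 0 - (z.1 1 * v.2 0 + z.2 0 * v.1 1)))) •
        keplerField z := by
  have hz' : ‖z.1‖ ≠ 0 := norm_ne_zero_iff.2 hz
  have hμ' := (hasDerivAt_inv hμ).comp_hasFDerivAt z
    (((hasDerivAt_inv hz').comp_hasFDerivAt z (hasFDerivAt_norm_fst hz)).add
      (hasFDerivAt_angularMomentum z))
  have h : HasFDerivAt reebFormula _ z := hμ'.smul (hasFDerivAt_keplerField hz)
  rw [(reebField_eventuallyEq hz).fderiv_eq, h.fderiv]
  have hsub (a b : Phase) (s t : ℝ) (w : Phase) (hab : a = b) (hst : s = -t) :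
      a + s • w = b - t • w := by rw [hab, hst, neg_smul, sub_eq_add_neg]
  refine hsub _ _ _ _ _ rfl ?_
  simp [coordP, coordQ]
  ring


/-! ### Circular orbits -/

/-- The point at polar angle `θ` of the circular orbit of angular momentum `ℓ`. It has
`|q| = ℓ²` and `|p| = 1 / |ℓ|`. -/
def circ (ℓ θ : ℝ) : Phase :=
  (!₂[ℓ ^ 2 * Real.cos θ, ℓ ^ 2 * Real.sin θ], !₂[-(Real.sin θ / ℓ), Real.cos θ / ℓ])

variable {ℓ : ℝ}

lemma norm_eq_of_sq {n : ℕ} {x : EuclideanSpace ℝ (Fin n)} {r : ℝ} (hr : 0 ≤ r)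
    (h : ∑ i, x i ^ 2 = r ^ 2) : ‖x‖ = r := by
  rw [EuclideanSpace.norm_eq]
  simp only [Real.norm_eq_abs, sq_abs, h, Real.sqrt_sq hr]

lemma norm_circ_fst (ℓ θ : ℝ) : ‖(circ ℓ θ).1‖ = ℓ ^ 2 := by
  refine norm_eq_of_sq (sq_nonneg ℓ) ?_
  simp only [circ, Fin.sum_univ_two]
  simp
  linear_combination ℓ ^ 4 * Real.sin_sq_add_cos_sq θ

lemma norm_sq_circ_snd (hℓ : ℓ ≠ 0) (θ : ℝ) : ‖(circ ℓ θ).2‖ ^ 2 = (ℓ ^ 2)⁻¹ := by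
  rw [EuclideanSpace.norm_sq_eq]
  simp only [circ, Fin.sum_univ_two, Real.norm_eq_abs, sq_abs]
  simp
  field_simp
  linear_combination Real.sin_sq_add_cos_sq θ

lemma angularMomentum_circ (hℓ : ℓ ≠ 0) (θ : ℝ) : angularMomentum (circ ℓ θ) = ℓ := by
  simp [angularMomentum, circ]
  field_simp
  linear_combination Real.sin_sq_add_cos_sq θ

lemma circ_fst_ne_zero (hℓ : ℓ ≠ 0) (θ : ℝ) : (circ ℓ θ).1 ≠ 0 := by
  rw [← norm_ne_zero_iff, norm_circ_fst]
  positivity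

lemma rot_circ (ℓ a θ : ℝ) : rot a (circ ℓ θ) = circ ℓ (a + θ) := by
  rw [rot_apply]
  apply phase_ext <;> simp [circ, Real.cos_add, Real.sin_add] <;> ring

lemma hasDerivAt_circ (ℓ θ : ℝ) : HasDerivAt (circ ℓ) (rotGen (circ ℓ θ)) θ := by
  have h : circ ℓ = fun θ => rot θ (circ ℓ 0) := by
    ext1 θ
    rw [rot_circ, add_zero]
  rw [h]
  simpa using (hasDerivAt_rot θ).clm_apply (hasDerivAt_const θ (circ ℓ 0))

lemma keplerField_circ (hℓ : ℓ ≠ 0) (θ : ℝ) :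
    keplerField (circ ℓ θ) = (1 + (ℓ ^ 3)⁻¹) • rotGen (circ ℓ θ) := by
  simp only [keplerField, norm_circ_fst]
  apply phase_ext <;> simp [circ, rotGen_apply] <;> field_simp <;> ring

lemma liouvilleForm_circ (hℓ : ℓ ≠ 0) (θ : ℝ) :
    liouvilleForm (circ ℓ θ) (hamiltonianVectorField hamiltonian (circ ℓ θ)) =
      (ℓ ^ 2)⁻¹ + ℓ := by
  rw [hamiltonianVectorField_eq (circ_fst_ne_zero hℓ θ),
    liouvilleForm_keplerField (circ_fst_ne_zero hℓ θ), norm_circ_fst, angularMomentum_circ hℓ]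

lemma reebField_circ (hℓ : ℓ ≠ 0) (h3 : 0 < 1 + ℓ ^ 3) (θ : ℝ) :
    reebField (circ ℓ θ) = ℓ⁻¹ • rotGen (circ ℓ θ) := by
  rw [reebField_eq (circ_fst_ne_zero hℓ θ), reebFormula, norm_circ_fst, angularMomentum_circ hℓ,
    keplerField_circ hℓ, smul_smul]
  congr 1
  have : (ℓ ^ 2)⁻¹ + ℓ = (1 + ℓ ^ 3) / ℓ ^ 2 := by field_simp
  rw [this]
  field_simp
  ring

/-! ### The linearized Reeb flow along a circular orbit -/

/-- The tangent vector at `circ ℓ θ` which moves `q` in the direction of the polar angle. -/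
def angularVec (θ : ℝ) : Phase := (!₂[-Real.sin θ, Real.cos θ], 0)

/-- The tangent vector at `circ ℓ θ` which moves `q` radially and `p` such that the Hamiltonian
and the vanishing of `λ` are preserved. -/
def radialVec (ℓ θ : ℝ) : Phase :=
  (!₂[Real.cos θ, Real.sin θ], !₂[Real.sin θ / ℓ ^ 3, -(Real.cos θ / ℓ ^ 3)])

lemma rot_angularVec (a θ : ℝ) : rot a (angularVec θ) = angularVec (a + θ) := by
  rw [rot_apply]
  apply phase_ext <;> simp [angularVec, Real.cos_add, Real.sin_add] <;> ring

lemma rot_radialVec (ℓ a θ : ℝ) : rot a (radialVec ℓ θ) = radialVec ℓ (a + θ) := by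
  rw [rot_apply]
  apply phase_ext <;> simp [radialVec, Real.cos_add, Real.sin_add] <;> ring

/-- The frequency, in Reeb time, of the epicyclic motion about a circular orbit. -/
def epicyclicFreq (ℓ : ℝ) : ℝ := (ℓ * (1 + ℓ ^ 3))⁻¹

lemma fderiv_reebField_angularVec (hℓ : ℓ ≠ 0) (h3 : 0 < 1 + ℓ ^ 3) (θ : ℝ) :
    fderiv ℝ reebField (circ ℓ θ) (angularVec θ) =
      ℓ⁻¹ • rotGen (angularVec θ) + epicyclicFreq ℓ • radialVec ℓ θ := by
  have hμ : (ℓ ^ 2)⁻¹ + ℓ = (1 + ℓ ^ 3) / ℓ ^ 2 := by field_simp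
  have hz := circ_fst_ne_zero hℓ θ
  have hne : ‖(circ ℓ θ).1‖⁻¹ + angularMomentum (circ ℓ θ) ≠ 0 := by
    rw [norm_circ_fst, angularMomentum_circ hℓ, hμ]; positivity
  rw [fderiv_reebField_apply hz hne, norm_circ_fst, angularMomentum_circ hℓ, hμ,
    keplerField_circ hℓ]
  have hin : inner ℝ (circ ℓ θ).1 (angularVec θ).1 = 0 := by
    simp [PiLp.inner_apply, Fin.sum_univ_two, circ, angularVec]
    ring
  have hL : (circ ℓ θ).1 0 * (angularVec θ).2 1 + (circ ℓ θ).2 1 * (angularVec θ).1 0 -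
      ((circ ℓ θ).1 1 * (angularVec θ).2 0 + (circ ℓ θ).2 0 * (angularVec θ).1 1) = 0 := by
    simp [circ, angularVec]
    ring
  rw [hin, hL]
  apply phase_ext <;> simp [circ, rotGen_apply, angularVec, radialVec, epicyclicFreq] <;>
    field_simp <;> ring

lemma fderiv_reebField_radialVec (hℓ : ℓ ≠ 0) (h3 : 0 < 1 + ℓ ^ 3) (θ : ℝ) :
    fderiv ℝ reebField (circ ℓ θ) (radialVec ℓ θ) =
      ℓ⁻¹ • rotGen (radialVec ℓ θ) - epicyclicFreq ℓ • angularVec θ := by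
  have hμ : (ℓ ^ 2)⁻¹ + ℓ = (1 + ℓ ^ 3) / ℓ ^ 2 := by field_simp
  have hz := circ_fst_ne_zero hℓ θ
  have hne : ‖(circ ℓ θ).1‖⁻¹ + angularMomentum (circ ℓ θ) ≠ 0 := by
    rw [norm_circ_fst, angularMomentum_circ hℓ, hμ]; positivity
  have hcs := Real.sin_sq_add_cos_sq θ
  rw [fderiv_reebField_apply hz hne, norm_circ_fst, angularMomentum_circ hℓ, hμ,
    keplerField_circ hℓ]
  have hin : inner ℝ (circ ℓ θ).1 (radialVec ℓ θ).1 = ℓ ^ 2 := by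
    simp [PiLp.inner_apply, Fin.sum_univ_two, circ, radialVec]
    linear_combination ℓ ^ 2 * hcs
  have hL : (circ ℓ θ).1 0 * (radialVec ℓ θ).2 1 + (circ ℓ θ).2 1 * (radialVec ℓ θ).1 0 -
      ((circ ℓ θ).1 1 * (radialVec ℓ θ).2 0 + (circ ℓ θ).2 0 * (radialVec ℓ θ).1 1) = 0 := by
    simp [circ, radialVec]
    field_simp
    ring
  rw [hin, hL]
  apply phase_ext <;> simp [circ, rotGen_apply, angularVec, radialVec, epicyclicFreq] <;>
    field_simp <;> ring


/-! ### The global frame along a circular orbit -/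

/-- The coordinate `ξᵢ` as a continuous linear map. -/
def coordXi (i : Fin 3) : Ambient →L[ℝ] ℝ :=
  (EuclideanSpace.proj i).comp (ContinuousLinearMap.fst ℝ _ _)

/-- The coordinate `ηᵢ` as a continuous linear map. -/
def coordEta (i : Fin 3) : Ambient →L[ℝ] ℝ :=
  (EuclideanSpace.proj i).comp (ContinuousLinearMap.snd ℝ _ _)

lemma fderiv_regularizedHamiltonian_apply (c : ℝ) {w : Ambient} (hw : w.2 ≠ 0) (v : Ambient) :
    fderiv ℝ (regularizedHamiltonian c) w v =
      ‖w.2‖⁻¹ * inner ℝ w.2 v.2 *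
        (1 + (1 - w.1 2) * (c - 1 / 2 + (w.1 0 * w.2 1 - w.1 1 * w.2 0)))
      + ‖w.2‖ * (-v.1 2 * (c - 1 / 2 + (w.1 0 * w.2 1 - w.1 1 * w.2 0))
        + (1 - w.1 2) *
          (v.1 0 * w.2 1 + w.1 0 * v.2 1 - (v.1 1 * w.2 0 + w.1 1 * v.2 0))) := by
  have hn : HasFDerivAt (fun w : Ambient => ‖w.2‖) _ w :=
    (hasFDerivAt_norm hw).comp w hasFDerivAt_snd
  have hL := ((coordXi 0).hasFDerivAt.mul (coordEta 1).hasFDerivAt).sub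
    ((coordXi 1).hasFDerivAt.mul (coordEta 0).hasFDerivAt) (x := w)
  have h : HasFDerivAt (regularizedHamiltonian c) _ w :=
    (hn.mul ((((coordXi 2).hasFDerivAt.const_sub 1).mul
      (hL.const_add (c - 1 / 2))).const_add 1)).sub_const 1
  rw [h.fderiv]
  simp [coordXi, coordEta]
  ring

lemma differentiableAt_stereo {w : Ambient} (hw : 1 - w.1 2 ≠ 0) :
    DifferentiableAt ℝ stereo w := by
  have hx (i : Fin 3) : DifferentiableAt ℝ (fun w : Ambient => w.1 i) w :=
    (coordXi i).differentiableAt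
  have he (i : Fin 3) : DifferentiableAt ℝ (fun w : Ambient => w.2 i) w :=
    (coordEta i).differentiableAt
  have h1 : DifferentiableAt ℝ (fun w : Ambient => 1 - w.1 2) w := (hx 2).const_sub 1
  refine DifferentiableAt.prodMk (differentiableAt_euclidean.2 ?_) (differentiableAt_euclidean.2 ?_)
  · rw [Fin.forall_fin_two]
    exact ⟨((h1.mul (he 0)).add ((he 2).mul (hx 0))).neg,
      ((h1.mul (he 1)).add ((he 2).mul (hx 1))).neg⟩
  · rw [Fin.forall_fin_two]
    exact ⟨(hx 0).mul (h1.inv hw), (hx 1).mul (h1.inv hw)⟩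

lemma fderiv_stereo_apply {w : Ambient} (hw : 1 - w.1 2 ≠ 0) (v : Ambient) :
    fderiv ℝ stereo w v =
      (!₂[-((1 - w.1 2) * v.2 0 - v.1 2 * w.2 0 + (w.2 2 * v.1 0 + v.2 2 * w.1 0)),
          -((1 - w.1 2) * v.2 1 - v.1 2 * w.2 1 + (w.2 2 * v.1 1 + v.2 2 * w.1 1))],
       !₂[v.1 0 / (1 - w.1 2) + w.1 0 * v.1 2 / (1 - w.1 2) ^ 2,
          v.1 1 / (1 - w.1 2) + w.1 1 * v.1 2 / (1 - w.1 2) ^ 2]) := by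
  have hd := (differentiableAt_stereo hw).hasFDerivAt
  have hx (i : Fin 3) : HasFDerivAt (fun w : Ambient => w.1 i) (coordXi i) w :=
    (coordXi i).hasFDerivAt
  have he (i : Fin 3) : HasFDerivAt (fun w : Ambient => w.2 i) (coordEta i) w :=
    (coordEta i).hasFDerivAt
  have h1 : HasFDerivAt (fun w : Ambient => 1 - w.1 2) (-coordXi 2) w := (hx 2).const_sub 1
  have hi := (hasDerivAt_inv hw).comp_hasFDerivAt w h1
  have hq0 := ((coordQ 0).hasFDerivAt.comp w hd).unique
    ((h1.mul (he 0)).add ((he 2).mul (hx 0))).neg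
  have hq1 := ((coordQ 1).hasFDerivAt.comp w hd).unique
    ((h1.mul (he 1)).add ((he 2).mul (hx 1))).neg
  have hp0 := ((coordP 0).hasFDerivAt.comp w hd).unique ((hx 0).mul hi)
  have hp1 := ((coordP 1).hasFDerivAt.comp w hd).unique ((hx 1).mul hi)
  apply phase_ext
  · refine (DFunLike.congr_fun hq0 v).trans ?_
    simp [coordXi, coordEta]; ring
  · refine (DFunLike.congr_fun hq1 v).trans ?_
    simp [coordXi, coordEta]; ring
  · refine (DFunLike.congr_fun hp0 v).trans ?_
    simp [coordXi]; field_simp; ring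
  · refine (DFunLike.congr_fun hp1 v).trans ?_
    simp [coordXi]; field_simp; ring

/-- In `T*S²` a circular orbit is a circle of latitude, traversed by `ξ`, with `η` tangent to it. -/
lemma stereoInv_circ (hℓ : ℓ ≠ 0) (θ : ℝ) : stereoInv (circ ℓ θ) =
    (!₂[-(2 * ℓ / (1 + ℓ ^ 2) * Real.sin θ), 2 * ℓ / (1 + ℓ ^ 2) * Real.cos θ,
        (1 - ℓ ^ 2) / (1 + ℓ ^ 2)],
     !₂[-((1 + ℓ ^ 2) / 2 * Real.cos θ), -((1 + ℓ ^ 2) / 2 * Real.sin θ), 0]) := by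
  have hin : inner ℝ (circ ℓ θ).2 (circ ℓ θ).1 = 0 := by
    simp [PiLp.inner_apply, Fin.sum_univ_two, circ]
    ring
  have h3 : 1 + ℓ ^ 2 ≠ 0 := by positivity
  have h4 : (ℓ ^ 2)⁻¹ + 1 = (1 + ℓ ^ 2) / ℓ ^ 2 := by field_simp
  have h5 : (ℓ ^ 2)⁻¹ - 1 = (1 - ℓ ^ 2) / ℓ ^ 2 := by field_simp
  rw [stereoInv, hin, norm_sq_circ_snd hℓ, h4, h5]
  refine Prod.ext ?_ ?_ <;> ext i <;> fin_cases i <;> simp [circ] <;> field_simp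

lemma norm_stereoInv_circ_snd (hℓ : ℓ ≠ 0) (θ : ℝ) :
    ‖(stereoInv (circ ℓ θ)).2‖ = (1 + ℓ ^ 2) / 2 := by
  refine norm_eq_of_sq (by positivity) ?_
  rw [stereoInv_circ hℓ]
  simp [Fin.sum_univ_three]
  linear_combination ((1 + ℓ ^ 2) / 2) ^ 2 * Real.sin_sq_add_cos_sq θ

lemma crossVec_stereoInv_circ (hℓ : ℓ ≠ 0) (θ : ℝ) : crossVec (stereoInv (circ ℓ θ)) =
    !₂[(1 - ℓ ^ 2) / 2 * Real.sin θ, -((1 - ℓ ^ 2) / 2 * Real.cos θ), ℓ] := by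
  have h3 : 1 + ℓ ^ 2 ≠ 0 := by positivity
  rw [crossVec, stereoInv_circ hℓ]
  ext i
  fin_cases i <;> simp [cross_apply] <;> field_simp
  linear_combination Real.sin_sq_add_cos_sq θ

lemma norm_crossVec_stereoInv_circ (hℓ : ℓ ≠ 0) (θ : ℝ) :
    ‖crossVec (stereoInv (circ ℓ θ))‖ = (1 + ℓ ^ 2) / 2 := by
  refine norm_eq_of_sq (by positivity) ?_
  rw [crossVec_stereoInv_circ hℓ]
  simp [Fin.sum_univ_three]
  linear_combination ((1 - ℓ ^ 2) / 2) ^ 2 * Real.sin_sq_add_cos_sq θ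

lemma hamiltonian_circ (hℓ : ℓ ≠ 0) (θ : ℝ) : hamiltonian (circ ℓ θ) = ℓ - (2 * ℓ ^ 2)⁻¹ := by
  rw [hamiltonian, keplerEnergy, norm_sq_circ_snd hℓ, norm_circ_fst, angularMomentum_circ hℓ]
  field_simp
  ring

/-- Along a circular orbit the frame consists of the multiples `-2ℓ² / (1 + ℓ²)` and
`-ℓ (1 + ℓ²) / 2` of the angular and the radial vector. The energy
in the definition of the frame may be evaluated at any point `circ ℓ θ'` of the orbit. -/
lemma contactFrame_circ (hℓ : ℓ ≠ 0) (h3 : 0 < 1 + ℓ ^ 3) (θ θ' : ℝ) :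
    contactFrame (-hamiltonian (circ ℓ θ')) (circ ℓ θ) =
      Sum.elim (fun _ => -(2 * ℓ ^ 2 / (1 + ℓ ^ 2)) • angularVec θ)
        (fun _ => -(ℓ * (1 + ℓ ^ 2) / 2) • radialVec ℓ θ) := by
  have h1 : 1 + ℓ ^ 2 ≠ 0 := by positivity
  have hcs := Real.sin_sq_add_cos_sq θ
  set c := -hamiltonian (circ ℓ θ') with hc
  rw [hamiltonian_circ hℓ] at hc
  set w := stereoInv (circ ℓ θ) with hw
  have hn : ‖w.2‖ = (1 + ℓ ^ 2) / 2 := norm_stereoInv_circ_snd hℓ θ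
  have hw2 : w.2 ≠ 0 := by
    rw [← norm_ne_zero_iff, hn]; positivity
  have hx := crossVec_stereoInv_circ hℓ θ
  have hxn := norm_crossVec_stereoInv_circ hℓ θ
  rw [← hw] at hx hxn
  rw [stereoInv_circ hℓ θ] at hw
  have hM : c - 1 / 2 + (w.1 0 * w.2 1 - w.1 1 * w.2 0) = (1 - ℓ ^ 2) / (2 * ℓ ^ 2) := by
    rw [hc, hw]
    simp
    field_simp
    linear_combination 2 * ℓ ^ 3 * hcs
  have hξ : 1 - w.1 2 = 2 * ℓ ^ 2 / (1 + ℓ ^ 2) := by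
    rw [hw]
    simp
    field_simp
    ring
  have hξ0 : 1 - w.1 2 ≠ 0 := by rw [hξ]; positivity
  have hK (v : Ambient) := fderiv_regularizedHamiltonian_apply c hw2 v
  rw [hM, hξ, hn] at hK
  -- the denominator `η · ∂_η K` of the frame does not vanish
  have hη : fderiv ℝ (regularizedHamiltonian c) w (0, w.2) = 1 + ℓ ^ 3 := by
    rw [hK, real_inner_self_eq_norm_sq, hn, hw]
    simp
    field_simp
    linear_combination (2 * ℓ ^ 3) * hcs
  have hX1 : fderiv ℝ (regularizedHamiltonian c) w (0, crossVec w) = 0 := by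
    rw [hK, hx, hw]
    simp [PiLp.inner_apply, Fin.sum_univ_three]
    field_simp
    ring
  have hX2 : fderiv ℝ (regularizedHamiltonian c) w (crossVec w, 0) =
      -((1 + ℓ ^ 2) * (1 - ℓ ^ 2) / (4 * ℓ)) * (1 + ℓ ^ 3) := by
    rw [hK, hx, hw]
    simp
    field_simp
    linear_combination (-4 * ℓ ^ 3 * (1 - ℓ ^ 2)) * hcs
  have h3' : 1 + ℓ ^ 3 ≠ 0 := h3.ne'
  have hF1 : fderiv ℝ stereo w (‖crossVec w‖⁻¹ • globalX₁ c w) =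
      -(2 * ℓ ^ 2 / (1 + ℓ ^ 2)) • angularVec θ := by
    rw [fderiv_stereo_apply hξ0, hξ, hxn, globalX₁, hX1, zero_div, zero_smul, sub_zero, hx, hw]
    apply phase_ext <;> simp [angularVec] <;> field_simp <;> ring
  have hF2 : fderiv ℝ stereo w (‖crossVec w‖⁻¹ • globalX₂ c w) =
      -(ℓ * (1 + ℓ ^ 2) / 2) • radialVec ℓ θ := by
    rw [fderiv_stereo_apply hξ0, hξ, hxn, globalX₂, hX2, hη, mul_div_cancel_right₀ _ h3', hx, hw]
    apply phase_ext <;> simp [radialVec] <;> field_simp <;> ring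
  exact congrArg₂ Sum.elim (funext fun _ => hF1) (funext fun _ => hF2)


/-! ### Solutions of the linearized Reeb equation -/

lemma hasDerivAt_rot_apply (θ : ℝ) (z : Phase) :
    HasDerivAt (fun θ => rot θ z) (rotGen (rot θ z)) θ := by
  simpa using (hasDerivAt_rot θ).clm_apply (hasDerivAt_const θ z)

lemma hasDerivAt_angularVec (θ : ℝ) :
    HasDerivAt angularVec (rotGen (angularVec θ)) θ := by
  have h : angularVec = fun θ => rot θ (angularVec 0) := by
    ext1 θ
    rw [rot_angularVec, add_zero]
  have h' := hasDerivAt_rot_apply θ (angularVec 0)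
  rwa [← h, rot_angularVec, add_zero] at h'

lemma hasDerivAt_radialVec (ℓ θ : ℝ) :
    HasDerivAt (radialVec ℓ) (rotGen (radialVec ℓ θ)) θ := by
  have h : radialVec ℓ = fun θ => rot θ (radialVec ℓ 0) := by
    ext1 θ
    rw [rot_radialVec, add_zero]
  have h' := hasDerivAt_rot_apply θ (radialVec ℓ 0)
  rwa [← h, rot_radialVec, add_zero] at h'

lemma hasDerivAt_angle (ℓ θ₀ s : ℝ) : HasDerivAt (fun s => θ₀ + ℓ⁻¹ * s) ℓ⁻¹ s := by
  simpa using ((hasDerivAt_id s).const_mul ℓ⁻¹).const_add θ₀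

/-- In the frame that rotates with the orbit, the linearized Reeb flow turns the angular vector into
the radial vector and the radial vector into the opposite of the angular vector; the constants
`a`, `b` fix the initial value. -/
lemma hasDerivAt_epicycle (hℓ : ℓ ≠ 0) (h3 : 0 < 1 + ℓ ^ 3) (θ₀ a b s : ℝ) :
    HasDerivAt (fun s =>
        (a * Real.cos (epicyclicFreq ℓ * s) - b * Real.sin (epicyclicFreq ℓ * s)) •
          angularVec (θ₀ + ℓ⁻¹ * s) +
        (a * Real.sin (epicyclicFreq ℓ * s) + b * Real.cos (epicyclicFreq ℓ * s)) •
          radialVec ℓ (θ₀ + ℓ⁻¹ * s))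
      (fderiv ℝ reebField (circ ℓ (θ₀ + ℓ⁻¹ * s))
        ((a * Real.cos (epicyclicFreq ℓ * s) - b * Real.sin (epicyclicFreq ℓ * s)) •
          angularVec (θ₀ + ℓ⁻¹ * s) +
        (a * Real.sin (epicyclicFreq ℓ * s) + b * Real.cos (epicyclicFreq ℓ * s)) •
          radialVec ℓ (θ₀ + ℓ⁻¹ * s))) s := by
  have hν : HasDerivAt (fun s : ℝ => epicyclicFreq ℓ * s) (epicyclicFreq ℓ) s := by
    simpa using (hasDerivAt_id s).const_mul (epicyclicFreq ℓ)
  have hA := (hasDerivAt_angularVec (θ₀ + ℓ⁻¹ * s)).scomp s (hasDerivAt_angle ℓ θ₀ s)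
  have hR := (hasDerivAt_radialVec ℓ (θ₀ + ℓ⁻¹ * s)).scomp s (hasDerivAt_angle ℓ θ₀ s)
  have h := (((hν.cos.const_mul a).sub (hν.sin.const_mul b)).smul hA).add
    (((hν.sin.const_mul a).add (hν.cos.const_mul b)).smul hR)
  refine h.congr_deriv ?_
  simp only [map_add, map_smul, fderiv_reebField_angularVec hℓ h3,
    fderiv_reebField_radialVec hℓ h3, Function.comp_apply, Pi.sub_apply, Pi.add_apply]
  module

/-- Linearized Reeb fields at different points of a circular orbit are conjugate by rotations. -/
lemma fderiv_reebField_circ (hℓ : ℓ ≠ 0) (a θ : ℝ) : fderiv ℝ reebField (circ ℓ (a + θ)) =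
    ((rot a).comp (fderiv ℝ reebField (circ ℓ θ))).comp (rot (-a)) := by
  rw [← fderiv_reebField_rot a (circ_fst_ne_zero hℓ θ), rot_circ]
  ext1 <;> ext1 v <;> simp [rot_rot, rot_zero]

lemma norm_rot_le (θ : ℝ) : ‖rot θ‖ ≤ 1 + ‖rotGen‖ := by
  refine (norm_add_le _ _).trans (add_le_add ?_ ?_)
  · rw [norm_smul, Real.norm_eq_abs]
    exact mul_le_one₀ (Real.abs_cos_le_one θ) (norm_nonneg _) ContinuousLinearMap.norm_id_le
  · rw [norm_smul, Real.norm_eq_abs]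
    exact mul_le_of_le_one_left (norm_nonneg _) (Real.abs_sin_le_one θ)

/-- The linearized Reeb equation along a circular orbit has bounded coefficients, whence uniqueness
of solutions. -/
lemma linearized_unique (hℓ : ℓ ≠ 0) (θ₀ : ℝ) {y₁ y₂ : ℝ → Phase}
    (h₁ : ∀ s, HasDerivAt y₁ (fderiv ℝ reebField (circ ℓ (θ₀ + ℓ⁻¹ * s)) (y₁ s)) s)
    (h₂ : ∀ s, HasDerivAt y₂ (fderiv ℝ reebField (circ ℓ (θ₀ + ℓ⁻¹ * s)) (y₂ s)) s)
    (h0 : y₁ 0 = y₂ 0) : y₁ = y₂ := by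
  set A := fderiv ℝ reebField (circ ℓ θ₀)
  set K : ℝ := (1 + ‖rotGen‖) * ‖A‖ * (1 + ‖rotGen‖)
  have hb (s : ℝ) : ‖fderiv ℝ reebField (circ ℓ (θ₀ + ℓ⁻¹ * s))‖₊ ≤ K.toNNReal := by
    rw [← NNReal.coe_le_coe, coe_nnnorm, Real.coe_toNNReal _ (by positivity), add_comm θ₀,
      fderiv_reebField_circ hℓ]
    refine (ContinuousLinearMap.opNorm_comp_le _ _).trans ?_
    refine mul_le_mul ((ContinuousLinearMap.opNorm_comp_le _ _).trans ?_) (norm_rot_le _)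
      (norm_nonneg _) (by positivity)
    exact mul_le_mul_of_nonneg_right (norm_rot_le _) (norm_nonneg _)
  exact ODE_solution_unique_univ
    (v := fun s => fderiv ℝ reebField (circ ℓ (θ₀ + ℓ⁻¹ * s))) (s := fun _ => Set.univ)
    (fun s => (ContinuousLinearMap.lipschitz _ |>.weaken (hb s)).lipschitzOnWith)
    (fun s => ⟨h₁ s, trivial⟩) (fun s => ⟨h₂ s, trivial⟩) h0

/-- The linearized Reeb flow exists: in the frame that rotates with the orbit the equation has
constant coefficients. -/
lemma exists_linearizedFlow (hℓ : ℓ ≠ 0) (θ₀ : ℝ) : ∃ Φ : ℝ → Phase →L[ℝ] Phase,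
    Φ 0 = ContinuousLinearMap.id ℝ Phase ∧
    ∀ s, HasDerivAt Φ ((fderiv ℝ reebField (circ ℓ (θ₀ + ℓ⁻¹ * s))).comp (Φ s)) s := by
  set B : Phase →L[ℝ] Phase := fderiv ℝ reebField (circ ℓ θ₀) - ℓ⁻¹ • rotGen with hB
  refine ⟨fun s => (rot (ℓ⁻¹ * s)).comp (NormedSpace.exp (s • B)), ?_, fun s => ?_⟩
  · have h0 : (0 : ℝ) • B = 0 := zero_smul ℝ B
    simp only [mul_zero, rot_zero, h0, NormedSpace.exp_zero]
    rfl
  · have hl : HasDerivAt (fun s : ℝ => ℓ⁻¹ * s) ℓ⁻¹ s := by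
      simpa using (hasDerivAt_id s).const_mul ℓ⁻¹
    have h := ((hasDerivAt_rot (ℓ⁻¹ * s)).scomp s hl).clm_comp (hasDerivAt_exp_smul_const' B s)
    refine h.congr_deriv (ContinuousLinearMap.ext fun v => ?_)
    rw [add_comm θ₀, fderiv_reebField_circ hℓ]
    simp [rot_rot, rot_zero, hB, rotGen_rot]

/-! ### The linearized Reeb flow in the global frame -/

lemma frame_coeff_unique (θ x y x' y' : ℝ)
    (h : x • angularVec θ + y • radialVec ℓ θ = x' • angularVec θ + y' • radialVec ℓ θ) :
    x = x' ∧ y = y' := by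
  have h0 := congrArg (fun z : Phase => z.1 0) h
  have h1 := congrArg (fun z : Phase => z.1 1) h
  simp [angularVec, radialVec] at h0 h1
  have hcs := Real.sin_sq_add_cos_sq θ
  constructor
  · linear_combination Real.cos θ * h1 - Real.sin θ * h0 - (x - x') * hcs
  · linear_combination Real.cos θ * h0 + Real.sin θ * h1 - (y - y') * hcs

/-- The ratio of the factors `-2ℓ² / (1 + ℓ²)` and `-ℓ (1 + ℓ²) / 2` by which the two frame vectors
along a circular orbit differ from the angular and the radial vector. -/
def frameRatio (ℓ : ℝ) : ℝ := 4 * ℓ / (1 + ℓ ^ 2) ^ 2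

lemma frameRatio_mul_epicyclicFreq_pos (hℓ : ℓ ≠ 0) (h3 : 0 < 1 + ℓ ^ 3) :
    0 < frameRatio ℓ * epicyclicFreq ℓ := by
  have : frameRatio ℓ * epicyclicFreq ℓ = 4 / ((1 + ℓ ^ 2) ^ 2 * (1 + ℓ ^ 3)) := by
    rw [frameRatio, epicyclicFreq]
    field_simp
  rw [this]
  positivity

/-- In the global frame the linearized Reeb flow along a circular orbit is an elliptic path. -/
lemma linearizedFlow_frame (hℓ : ℓ ≠ 0) (h3 : 0 < 1 + ℓ ^ 3) {θ₀ θ' : ℝ}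
    {Φ : ℝ → Phase →L[ℝ] Phase} (h0 : Φ 0 = ContinuousLinearMap.id ℝ Phase)
    (hΦ : ∀ s, HasDerivAt Φ ((fderiv ℝ reebField (circ ℓ (θ₀ + ℓ⁻¹ * s))).comp (Φ s)) s)
    (s : ℝ) (j : Fin 1 ⊕ Fin 1) :
    Φ s (contactFrame (-hamiltonian (circ ℓ θ')) (circ ℓ θ₀) j) =
      ∑ i, SymplecticPath.ellipticPath (frameRatio ℓ) (epicyclicFreq ℓ) s i j •
        contactFrame (-hamiltonian (circ ℓ θ')) (circ ℓ (θ₀ + ℓ⁻¹ * s)) i := by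
  have hsol (v : Phase) (s : ℝ) : HasDerivAt (fun s => Φ s v)
      (fderiv ℝ reebField (circ ℓ (θ₀ + ℓ⁻¹ * s)) (Φ s v)) s := by
    simpa using (hΦ s).clm_apply (hasDerivAt_const s v)
  have key (a b : ℝ) := congrFun (linearized_unique hℓ θ₀
    (hsol (a • angularVec θ₀ + b • radialVec ℓ θ₀))
    (hasDerivAt_epicycle hℓ h3 θ₀ a b) (by simp [h0])) s
  simp only [contactFrame_circ hℓ h3]
  rcases j with j | j
  · have := key (-(2 * ℓ ^ 2 / (1 + ℓ ^ 2))) 0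
    simp only [zero_smul, add_zero, zero_mul, sub_zero] at this
    simp only [Sum.elim_inl, this]
    simp only [Fintype.sum_sum_type, Finset.univ_unique, Finset.sum_singleton, Sum.elim_inl,
      Sum.elim_inr, smul_smul, SymplecticPath.ellipticPath, Matrix.of_apply, frameRatio]
    refine congrArg₂ (· + ·) (congrArg (· • _) ?_) (congrArg (· • _) ?_)
    · ring
    · field_simp
      ring
  · have := key 0 (-(ℓ * (1 + ℓ ^ 2) / 2))
    simp only [zero_smul, zero_add, zero_mul, zero_sub] at this
    simp only [Sum.elim_inr, this]
    simp only [Fintype.sum_sum_type, Finset.univ_unique, Finset.sum_singleton, Sum.elim_inl,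
      Sum.elim_inr, smul_smul, SymplecticPath.ellipticPath, Matrix.of_apply, frameRatio]
    refine congrArg₂ (· + ·) (congrArg (· • _) ?_) (congrArg (· • _) ?_)
    · field_simp
      ring
    · ring

/-! ### Circular trajectories -/

/-- Vanishing eccentricity means that `|q| = L²` and that `p` is `L⁻³` times the quarter turn
of `q`. With `r = |q|` it reads `(r|p|² - 1)² + (q · p)² (2 / r - |p|²) = 0`, where `E < 0` makes
the last factor positive. -/
lemma eq_of_eccentricitySq_eq_zero {z : Phase} (hz : z.1 ≠ 0) (he : eccentricitySq z = 0) :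
    angularMomentum z ≠ 0 ∧ ‖z.1‖ = angularMomentum z ^ 2 ∧
      z.2 0 = -(z.1 1 / angularMomentum z ^ 3) ∧ z.2 1 = z.1 0 / angularMomentum z ^ 3 := by
  have hr : 0 < ‖z.1‖ := norm_pos_iff.2 hz
  have hr2 : ‖z.1‖ ^ 2 = z.1 0 ^ 2 + z.1 1 ^ 2 := by
    simp [EuclideanSpace.norm_sq_eq, Fin.sum_univ_two]
  have hp2 : ‖z.2‖ ^ 2 = z.2 0 ^ 2 + z.2 1 ^ 2 := by
    simp [EuclideanSpace.norm_sq_eq, Fin.sum_univ_two]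
  rw [eccentricitySq, keplerEnergy, hp2] at he
  set r := ‖z.1‖
  have hL : angularMomentum z = z.1 0 * z.2 1 - z.1 1 * z.2 0 := rfl
  set ℓ := angularMomentum z
  set x := z.2 0 ^ 2 + z.2 1 ^ 2 with hx
  set w := z.1 0 * z.2 0 + z.1 1 * z.2 1 with hw
  -- Lagrange's identity for `L² = |q|²|p|² - (q · p)²`
  have hlag : ℓ ^ 2 = r ^ 2 * x - w ^ 2 := by rw [hL, hr2, hx, hw]; ring
  have he' : (2 / r - x) * ℓ ^ 2 = 1 := by
    have : 2 * (1 / 2 * x - 1 / r) = -(2 / r - x) := by ring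
    rw [this] at he
    linarith
  have hℓ : ℓ ≠ 0 := by
    rintro h
    rw [h] at he'
    norm_num at he'
  have hpos : 0 < 2 / r - x := by
    by_contra! hle
    nlinarith [sq_nonneg ℓ]
  have hsum : (r * x - 1) ^ 2 + w ^ 2 * (2 / r - x) = 0 := by
    rw [hlag] at he'
    field_simp at he' ⊢
    linear_combination (-1 : ℝ) * he'
  have hw0 : w = 0 := by
    by_contra hne
    have : 0 < w ^ 2 * (2 / r - x) := by positivity
    nlinarith [sq_nonneg (r * x - 1)]
  have hrx : r * x = 1 := by
    rw [hw0] at hsum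
    have : (r * x - 1) ^ 2 = 0 := by linarith
    have := pow_eq_zero_iff (two_ne_zero) |>.1 this
    linarith
  have hrℓ : r = ℓ ^ 2 := by
    rw [hlag, hw0]
    linear_combination (-r) * hrx
  have hr4 : z.1 0 ^ 2 + z.1 1 ^ 2 = ℓ ^ 4 := by rw [← hr2, hrℓ]; ring
  refine ⟨hℓ, hrℓ, ?_, ?_⟩
  · field_simp
    refine mul_left_cancel₀ hℓ ?_
    linear_combination (-z.2 0) * hr4 + z.1 0 * hw0 + z.1 1 * hL
  · field_simp
    refine mul_left_cancel₀ hℓ ?_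
    linear_combination (-z.2 1) * hr4 + z.1 1 * hw0 - z.1 0 * hL

lemma exists_eq_circ {z : Phase} (hz : z.1 ≠ 0) (he : eccentricitySq z = 0) :
    ∃ θ, z = circ (angularMomentum z) θ := by
  obtain ⟨hℓ, hr, h2, h3⟩ := eq_of_eccentricitySq_eq_zero hz he
  set ℓ := angularMomentum z
  set u : ℂ := ⟨z.1 0, z.1 1⟩
  have hu : ‖u‖ = ℓ ^ 2 := by
    rw [← hr, EuclideanSpace.norm_eq, Complex.norm_def, Complex.normSq_apply]
    simp [Fin.sum_univ_two, u]
    ring_nf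
  have hc := Complex.norm_mul_cos_arg u
  have hs := Complex.norm_mul_sin_arg u
  rw [hu] at hc hs
  change _ = z.1 0 at hc
  change _ = z.1 1 at hs
  refine ⟨u.arg, phase_ext hc.symm hs.symm ?_ ?_⟩
  · rw [h2, ← hs]
    simp [circ]
    field_simp
  · rw [h3, ← hc]
    simp [circ]
    field_simp

/-- A circular trajectory moves with the constant angular velocity `1 + L⁻³`. -/
lemma eq_circ_of_isCircular {γ : ℝ → Phase} (hγ : IsTrajectory γ) (hcirc : IsCircular γ)
    (hsign : IsRetrograde γ ∨ IsDirect γ) :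
    ∃ θ₀, ∀ t, γ t = circ (angularMomentum (γ 0)) (θ₀ +
      (1 + (angularMomentum (γ 0) ^ 3)⁻¹) * t) := by
  -- `|q|` is constant since `q' ⊥ q`; so is `L`, whose sign is fixed and whose square is `|q|`
  have hd (t : ℝ) : HasDerivAt γ (keplerField (γ t)) t := by
    rw [← hamiltonianVectorField_eq (hγ t).1]
    exact (hγ t).2
  have hpt (t : ℝ) := eq_of_eccentricitySq_eq_zero (hγ t).1 (hcirc t)
  have hnorm (t : ℝ) : ‖(γ t).1‖ ^ 2 = ‖(γ 0).1‖ ^ 2 := by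
    have hder (t : ℝ) : HasDerivAt (fun t => ‖(γ t).1‖ ^ 2) 0 t := by
      have h1 : HasDerivAt (fun t => (γ t).1) (keplerField (γ t)).1 t :=
        fstL.hasFDerivAt.comp_hasDerivAt t (hd t)
      refine h1.norm_sq.congr_deriv ?_
      obtain ⟨-, -, h2, h3⟩ := hpt t
      simp [keplerField, PiLp.inner_apply, Fin.sum_univ_two, h2, h3]
      ring
    exact is_const_of_deriv_eq_zero (fun t => (hder t).differentiableAt)
      (fun t => (hder t).deriv) t 0
  have hL (t : ℝ) : angularMomentum (γ t) = angularMomentum (γ 0) := by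
    have h := hnorm t
    rw [(hpt t).2.1, (hpt 0).2.1] at h
    have h' : angularMomentum (γ t) ^ 2 = angularMomentum (γ 0) ^ 2 :=
      (sq_eq_sq₀ (sq_nonneg _) (sq_nonneg _)).1 h
    rcases sq_eq_sq_iff_eq_or_eq_neg.1 h' with h' | h'
    · exact h'
    · rcases hsign with hs | hs
      · linarith [hs t, hs 0]
      · linarith [hs t, hs 0]
  obtain ⟨θ₀, h0⟩ := exists_eq_circ (hγ 0).1 (hcirc 0)
  set ℓ := angularMomentum (γ 0)
  have hℓ : ℓ ≠ 0 := (hpt 0).1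
  set Ω := 1 + (ℓ ^ 3)⁻¹ with hΩ
  have hγ' (t : ℝ) : HasDerivAt γ ((Ω • rotGen) (γ t)) t := by
    obtain ⟨θ, h⟩ := exists_eq_circ (hγ t).1 (hcirc t)
    rw [hL t] at h
    have := hd t
    rwa [h, keplerField_circ hℓ, ← h] at this
  have hc (t : ℝ) : HasDerivAt (fun t => circ ℓ (θ₀ + Ω * t))
      ((Ω • rotGen) (circ ℓ (θ₀ + Ω * t))) t := by
    have hl : HasDerivAt (fun t : ℝ => θ₀ + Ω * t) Ω t := by
      simpa using ((hasDerivAt_id t).const_mul Ω).const_add θ₀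
    exact (hasDerivAt_circ ℓ (θ₀ + Ω * t)).scomp t hl
  refine ⟨θ₀, fun t => ?_⟩
  refine congrFun (ODE_solution_unique_univ (v := fun _ => Ω • rotGen) (s := fun _ => Set.univ)
    (t₀ := 0) (fun _ => (Ω • rotGen).lipschitz.lipschitzOnWith)
    (fun t => ⟨hγ' t, trivial⟩) (fun t => ⟨hc t, trivial⟩) ?_) t
  simpa using h0

lemma circ_eq_circ_iff (hℓ : ℓ ≠ 0) (a b : ℝ) :
    circ ℓ a = circ ℓ b ↔ ∃ n : ℤ, a - b = 2 * Real.pi * n := by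
  rw [← Real.Angle.angle_eq_iff_two_pi_dvd_sub]
  constructor
  · intro h
    have h0 := congrArg (fun z : Phase => z.1 0) h
    have h1 := congrArg (fun z : Phase => z.1 1) h
    simp [circ, hℓ] at h0 h1
    exact Real.Angle.cos_sin_inj h0 h1
  · intro h
    have hc : Real.cos a = Real.cos b := by rw [← Real.Angle.cos_coe, h, Real.Angle.cos_coe]
    have hs : Real.sin a = Real.sin b := by rw [← Real.Angle.sin_coe, h, Real.Angle.sin_coe]
    simp [circ, hc, hs]

lemma isMinimalPeriod_circ (hℓ : ℓ ≠ 0) {Ω θ₀ : ℝ} (hΩ : Ω ≠ 0) {γ : ℝ → Phase}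
    (hγ : ∀ t, γ t = circ ℓ (θ₀ + Ω * t)) : IsMinimalPeriod γ (2 * Real.pi / |Ω|) := by
  have hΩ' := abs_pos.2 hΩ
  refine ⟨⟨by positivity, fun t => ?_⟩, ?_⟩
  · rw [hγ, hγ, circ_eq_circ_iff hℓ]
    rcases abs_choice Ω with h | h
    · refine ⟨1, ?_⟩
      rw [h]
      push_cast
      field_simp
      ring
    · refine ⟨-1, ?_⟩
      rw [h]
      push_cast
      field_simp
      ring
  · rintro T ⟨hT, h⟩
    have h0 := h 0
    rw [hγ, hγ, circ_eq_circ_iff hℓ] at h0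
    obtain ⟨n, hn⟩ := h0
    have hn' : Ω * T = 2 * Real.pi * n := by linarith
    have hne : n ≠ 0 := by
      rintro rfl
      have : Ω * T = 0 := by simpa using hn'
      exact (mul_ne_zero hΩ hT.ne') this
    have habs : T * |Ω| = 2 * Real.pi * |(n : ℝ)| := by
      rw [← abs_of_pos hT, ← abs_mul, mul_comm, hn', abs_mul, abs_of_pos Real.two_pi_pos]
    have h1 : (1 : ℝ) ≤ |(n : ℝ)| := by exact_mod_cast Int.one_le_abs hne
    rw [div_le_iff₀ hΩ', habs]
    exact le_mul_of_one_le_right Real.two_pi_pos.le h1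

section

variable {γ : ℝ → Phase} {θ₀ : ℝ}

lemma action_circ (hℓ : ℓ ≠ 0) (hγ : ∀ t, γ t = circ ℓ (θ₀ + (1 + (ℓ ^ 3)⁻¹) * t))
    (hd : IsTrajectory γ) (t : ℝ) : action γ t = ((ℓ ^ 2)⁻¹ + ℓ) * t := by
  have h (s : ℝ) : liouvilleForm (γ s) (deriv γ s) = (ℓ ^ 2)⁻¹ + ℓ := by
    rw [(hd s).2.deriv, hγ s, liouvilleForm_circ hℓ]
  simp only [action, h, intervalIntegral.integral_const, sub_zero, smul_eq_mul]
  ring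

/-- Up to the identification of time with Reeb time, the linearized Reeb flow in the global frame
is the elliptic path of frequency `epicyclicFreq ℓ`. -/
lemma isContactLinearization_iff (hℓ : ℓ ≠ 0) (h3 : 0 < 1 + ℓ ^ 3)
    (hγ : ∀ t, γ t = circ ℓ (θ₀ + (1 + (ℓ ^ 3)⁻¹) * t)) (hd : IsTrajectory γ)
    (ψ : ℝ → Matrix (Fin 1 ⊕ Fin 1) (Fin 1 ⊕ Fin 1) ℝ) :
    IsContactLinearization γ ψ ↔
      ψ = SymplecticPath.ellipticPath (frameRatio ℓ) (epicyclicFreq ℓ) := by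
  have hκ : (ℓ ^ 2)⁻¹ + ℓ = (1 + ℓ ^ 3) / ℓ ^ 2 := by field_simp
  have hγ0 : γ 0 = circ ℓ θ₀ := by simpa using hγ 0
  constructor
  · rintro ⟨α, Φ, hα, -, hΦ0, hΦ, hψ⟩
    -- the action is a nonzero multiple of time, so it determines `α` everywhere
    have hαs (s : ℝ) : α s = circ ℓ (θ₀ + ℓ⁻¹ * s) := by
      have h := hα (s * (ℓ ^ 2 / (1 + ℓ ^ 3)))
      rw [action_circ hℓ hγ hd, hγ, hκ] at h
      have e1 : (1 + ℓ ^ 3) / ℓ ^ 2 * (s * (ℓ ^ 2 / (1 + ℓ ^ 3))) = s := by field_simp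
      have e2 : (1 + (ℓ ^ 3)⁻¹) * (s * (ℓ ^ 2 / (1 + ℓ ^ 3))) = ℓ⁻¹ * s := by
        field_simp
        ring
      rwa [e1, e2] at h
    simp only [hαs, hγ0, mul_zero, add_zero] at hΦ hψ
    funext s
    have hcol (j : Fin 1 ⊕ Fin 1) := (hψ s j).symm.trans (linearizedFlow_frame hℓ h3 hΦ0 hΦ s j)
    have hne1 : -(2 * ℓ ^ 2 / (1 + ℓ ^ 2)) ≠ 0 := neg_ne_zero.2 (by positivity)
    have hne2 : -(ℓ * (1 + ℓ ^ 2) / 2) ≠ 0 := neg_ne_zero.2 (by positivity)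
    simp only [contactFrame_circ hℓ h3, Fintype.sum_sum_type, Finset.univ_unique,
      Finset.sum_singleton, Sum.elim_inl, Sum.elim_inr, smul_smul] at hcol
    ext i j
    obtain ⟨hj1, hj2⟩ := frame_coeff_unique _ _ _ _ _ (hcol j)
    rcases i with i | i <;> fin_cases i
    · exact mul_right_cancel₀ hne1 hj1
    · exact mul_right_cancel₀ hne2 hj2
  · rintro rfl
    obtain ⟨Φ, hΦ0, hΦ⟩ := exists_linearizedFlow hℓ θ₀
    refine ⟨fun s => circ ℓ (θ₀ + ℓ⁻¹ * s), Φ, fun t => ?_, fun s => ?_, hΦ0, hΦ, fun s j => ?_⟩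
    · have e : ℓ⁻¹ * ((1 + ℓ ^ 3) / ℓ ^ 2 * t) = (1 + (ℓ ^ 3)⁻¹) * t := by
        field_simp
        ring
      change circ ℓ (θ₀ + ℓ⁻¹ * action γ t) = _
      rw [hγ, action_circ hℓ hγ hd, hκ, e]
    · rw [reebField_circ hℓ h3]
      exact (hasDerivAt_circ ℓ _).scomp s (hasDerivAt_angle ℓ θ₀ s)
    · simp only [hγ0, mul_zero, add_zero]
      exact linearizedFlow_frame hℓ h3 hΦ0 hΦ s j

/-- Nondegeneracy and index of a circular orbit in terms of the angular momentum `ℓ`: the epicyclic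
period is `2π|ℓ|³`. -/
lemma index_circ (hℓ : ℓ ≠ 0) (h3 : 0 < 1 + ℓ ^ 3)
    (hγ : ∀ t, γ t = circ ℓ (θ₀ + (1 + (ℓ ^ 3)⁻¹) * t)) (hd : IsTrajectory γ) {T τ : ℝ}
    (hT : 0 ≤ T) (hτ : τ = 2 * Real.pi * |ℓ| ^ 3) (hend : ∀ m : ℤ, T ≠ m * τ) :
    IsNondegenerateOrbit γ T ∧
      ∃ k : ℤ, IsGreatest {k : ℤ | (k : ℝ) * τ < T} k ∧
        HasConleyZehnderIndex γ T (1 + 2 * k) := by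
  have hT0 : 0 < T := lt_of_le_of_ne hT (by simpa using (hend 0).symm)
  have hτ0 : 0 < τ := by
    rw [hτ]
    have := abs_pos.2 hℓ
    positivity
  have hρν := frameRatio_mul_epicyclicFreq_pos hℓ h3
  have hκ : (ℓ ^ 2)⁻¹ + ℓ = (1 + ℓ ^ 3) / ℓ ^ 2 := by field_simp
  have hκ0 : 0 < (ℓ ^ 2)⁻¹ + ℓ := by
    rw [hκ]
    positivity
  have hact := action_circ hℓ hγ hd T
  have hlin := isContactLinearization_iff hℓ h3 hγ hd
  -- the epicyclic period in Reeb time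
  have hτR : ((ℓ ^ 2)⁻¹ + ℓ) * τ = 2 * Real.pi / |epicyclicFreq ℓ| := by
    rw [epicyclicFreq, abs_inv, abs_mul, abs_of_pos h3, hκ, hτ, ← sq_abs ℓ]
    have := abs_pos.2 hℓ
    field_simp
  have hendR (m : ℤ) : ((ℓ ^ 2)⁻¹ + ℓ) * T ≠ m * (((ℓ ^ 2)⁻¹ + ℓ) * τ) := by
    intro h
    refine hend m (mul_left_cancel₀ hκ0.ne' ?_)
    linarith
  have hk : IsGreatest {k : ℤ | (k : ℝ) * τ < T} (⌈T / τ⌉ - 1) := by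
    have (k : ℤ) : (k : ℝ) * τ < T ↔ k ≤ ⌈T / τ⌉ - 1 := by
      rw [Int.le_sub_one_iff, Int.lt_ceil, lt_div_iff₀ hτ0]
    exact ⟨(this _).2 le_rfl, fun k hk => (this k).1 hk⟩
  refine ⟨⟨⟨_, (hlin _).2 rfl⟩, fun ψ hψ h => ?_⟩, _, hk, ⟨⟨_, (hlin _).2 rfl⟩, fun ψ hψ => ?_⟩⟩
  · rw [(hlin ψ).1 hψ, hact] at h
    obtain ⟨m, hm⟩ := (SymplecticPath.isCrossing_ellipticPath_iff hρν hτR).1 h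
    exact hendR m hm
  · rw [(hlin ψ).1 hψ, hact]
    refine SymplecticPath.maslovIndex_ellipticPath hρν (by positivity) hτR ?_ hendR
    convert! hk using 3 with k
    rw [mul_left_comm]
    exact mul_lt_mul_iff_right₀ hκ0

end

lemma keplerEnergy_circ (hℓ : ℓ ≠ 0) (θ : ℝ) : keplerEnergy (circ ℓ θ) = -(2 * ℓ ^ 2)⁻¹ := by
  rw [keplerEnergy, norm_sq_circ_snd hℓ, norm_circ_fst]
  field_simp
  ring

lemma rpow_neg_two_mul_energy (hℓ : ℓ ≠ 0) :
    (-2 * -(2 * ℓ ^ 2)⁻¹) ^ (3 / 2 : ℝ) = (|ℓ| ^ 3)⁻¹ := by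
  have h0 := abs_pos.2 hℓ
  have h : -2 * -(2 * ℓ ^ 2)⁻¹ = |ℓ|⁻¹ ^ (2 : ℝ) := by
    rw [Real.rpow_two, inv_pow, sq_abs]
    field_simp
  rw [h, ← Real.rpow_mul (by positivity), ← inv_pow, ← Real.rpow_natCast]
  norm_num

end RotatingKepler
end

theorem mainTheorem3 (γ : ℝ → Phase) (hγ : IsTrajectory γ) (hcirc : IsCircular γ)
    (E : ℝ) (hE : keplerEnergy (γ 0) = E) :
    (IsRetrograde γ →
      ∃ S : ℝ, S = 2 * Real.pi / ((-2 * E) ^ (3 / 2 : ℝ) + 1) ∧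
        IsMinimalPeriod γ S ∧
        ∀ N : ℕ, (∀ m : ℤ, (N : ℝ) * S ≠ m * (2 * Real.pi / (-2 * E) ^ (3 / 2 : ℝ))) →
          IsNondegenerateOrbit γ (N * S) ∧
          ∃ k : ℤ,
            IsGreatest {k : ℤ | (k : ℝ) * (2 * Real.pi / (-2 * E) ^ (3 / 2 : ℝ)) < N * S} k ∧
            HasConleyZehnderIndex γ (N * S) (1 + 2 * k)) ∧
    (IsDirect γ → E < -1 / 2 →
      ∃ S : ℝ, S = 2 * Real.pi / ((-2 * E) ^ (3 / 2 : ℝ) - 1) ∧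
        IsMinimalPeriod γ S ∧
        ∀ N : ℕ, (∀ m : ℤ, (N : ℝ) * S ≠ m * (2 * Real.pi / (-2 * E) ^ (3 / 2 : ℝ))) →
          IsNondegenerateOrbit γ (N * S) ∧
          ∃ k : ℤ,
            IsGreatest {k : ℤ | (k : ℝ) * (2 * Real.pi / (-2 * E) ^ (3 / 2 : ℝ)) < N * S} k ∧
            HasConleyZehnderIndex γ (N * S) (1 + 2 * k)) := by
  have hℓ : angularMomentum (γ 0) ≠ 0 :=
    (eq_of_eccentricitySq_eq_zero (hγ 0).1 (hcirc 0)).1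
  have hEℓ : E = -(2 * angularMomentum (γ 0) ^ 2)⁻¹ := by
    obtain ⟨θ, h⟩ := exists_eq_circ (hγ 0).1 (hcirc 0)
    rw [← hE, ← keplerEnergy_circ hℓ θ, ← h]
  have hpow : (-2 * E) ^ (3 / 2 : ℝ) = (|angularMomentum (γ 0)| ^ 3)⁻¹ := by
    rw [hEℓ, rpow_neg_two_mul_energy hℓ]
  rw [hpow]
  refine ⟨fun hs => ?_, fun hs hlt => ?_⟩
  · obtain ⟨θ₀, hc⟩ := eq_circ_of_isCircular hγ hcirc (Or.inl hs)
    have hpos := hs 0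
    set ℓ := angularMomentum (γ 0)
    rw [abs_of_pos hpos]
    have hΩ : 0 < 1 + (ℓ ^ 3)⁻¹ := by positivity
    have hmin := isMinimalPeriod_circ hℓ hΩ.ne' hc
    rw [abs_of_pos hΩ, add_comm 1] at hmin
    refine ⟨_, rfl, hmin, fun N hN => ?_⟩
    refine index_circ hℓ (by positivity) hc hγ (by positivity) ?_ hN
    rw [abs_of_pos hpos, div_inv_eq_mul]
  · obtain ⟨θ₀, hc⟩ := eq_circ_of_isCircular hγ hcirc (Or.inr hs)
    have hneg := hs 0
    set ℓ := angularMomentum (γ 0)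
    have habs : 0 < |ℓ| := abs_pos.2 hℓ
    -- the energy bound says that `|ℓ| < 1`
    have hsq : |ℓ| ^ 2 < 1 := by
      rw [hEℓ] at hlt
      have h2 : (1 : ℝ) / 2 < (2 * ℓ ^ 2)⁻¹ := by linarith
      rw [lt_inv_comm₀ (by norm_num) (by positivity), one_div, inv_inv] at h2
      rw [sq_abs]
      linarith
    have hlt1 : |ℓ| ^ 3 < 1 := pow_lt_one₀ habs.le (by nlinarith) (by norm_num)
    have hcube : ℓ ^ 3 = -|ℓ| ^ 3 := by rw [abs_of_neg hneg]; ring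
    have hinv : 1 < (|ℓ| ^ 3)⁻¹ := (one_lt_inv₀ (by positivity)).2 hlt1
    have hΩ : 1 + (ℓ ^ 3)⁻¹ < 0 := by
      rw [hcube, inv_neg]
      linarith
    have hmin := isMinimalPeriod_circ hℓ hΩ.ne hc
    have hΩ' : |1 + (ℓ ^ 3)⁻¹| = (|ℓ| ^ 3)⁻¹ - 1 := by
      rw [abs_of_neg hΩ, hcube, inv_neg]
      ring
    rw [hΩ'] at hmin
    refine ⟨_, rfl, hmin, fun N hN => ?_⟩
    have hS : 0 ≤ 2 * Real.pi / ((|ℓ| ^ 3)⁻¹ - 1) :=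
      div_nonneg Real.two_pi_pos.le (by linarith)
    refine index_circ hℓ (by rw [hcube]; linarith) hc hγ (by positivity) ?_ hN
    rw [div_inv_eq_mul]
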